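/- Let $V=\mathbb{C}^2$ be the standard representation of $\mathrm{SL}(2,\mathbb{C})$. Identify $\mathbb{P}V=\mathbb{CP}^1$ with the unit sphere in $\mathbb{R}^3$ by stereographic projection, and identify $\mathbb{P}(S^dV)$ with the space $\operatorname{Sym}^d\mathbb{CP}^1$ of unordered $d$-tuples of points of $\mathbb{CP}^1$, by factorising binary forms of degree $d$. Let $C$ be the set of vertices of an equilateral triangle on a great circle of the sphere ($d=3$), or of a regular tetrahedron ($d=4$), octahedron ($d=6$) or icosahedron ($d=12$) inscribed in the sphere. Let $W_C\subset\mathbb{P}(S^dV)$ be the $\mathrm{SL}(2,\mathbb{C})$-orbit of $C$, let $X_C=\overline{W_C}$ be its closure (which is a smooth projective threefold), and let $L_C\subset W_C$ be the $\mathrm{SU}(2)$-orbit of $C$. For $A\in\mathrm{SL}(2,\mathbb{C})$ write $A^\ddag=(\overline{A}^{\,T})^{-1}$. Then: (0) The rule $\tau(A\cdot C)=A^\ddag\cdot C$ for $A\in\mathrm{SL}(2,\mathbb{C})$ gives a well-defined map $\tau\colon W_C\to W_C$. (1) Let $U\subset\mathbb{C}$ be an open neighbourhood of $0$ and let $u\colon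 U\to X_C$ be a holomorphic map with $u(U\setminus\{0\})\subset W_C$. Then $\tau\circ u|_{U\setminus\{0\}}$ extends to a continuous map $U\to X_C$. (2) Let $D=\{z\in\mathbb{C}:|z|\le 1\}$ and let $u\colon(D,\partial D)\to(X_C,L_C)$ be a holomorphic disc, that is, a continuous map $u\colon D\to X_C$ with $u(\partial D)\subset L_C$ that is holomorphic in the interior of $D$. Then there is a holomorphic map $\tilde u\colon\mathbb{CP}^1=\mathbb{C}\cup\{\infty\}\to X_C$ with $\tilde u(z)=u(z)$ for all $z\in D$ and $\tilde u(1/\overline z)=\tau(u(z))$ for all $z\in D$ with $u(z)\in W_C$ (where $1/\overline{0}=\infty$). -/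

import Mathlib

open scoped LinearAlgebra.Projectivization Topology

noncomputable section

namespace PlatonicLagrangian

/-! ## Complex projective space and holomorphic maps into it -/

/-- The standard (quotient) topology on a complex projective space. -/
instance projTopology {n : ℕ} : TopologicalSpace (ℙ ℂ (Fin n → ℂ)) :=
  TopologicalSpace.coinduced
    (fun v : {v : Fin n → ℂ // v ≠ 0} => Projectivization.mk ℂ v.1 v.2) inferInstance

/-- A map to projective space is holomorphic near `z` if on a neighbourhood of `z` it is given in
homogeneous coordinates by holomorphic functions without common zeros. -/
def HolomorphicNear {n : ℕ} (f : ℂ → ℙ ℂ (Fin n → ℂ)) (z : ℂ) : Prop :=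
  ∃ F : ℂ → Fin n → ℂ, ∀ᶠ y in 𝓝 z,
    DifferentiableAt ℂ F y ∧ ∃ h : F y ≠ 0, f y = Projectivization.mk ℂ (F y) h

/-- Holomorphy on an open set `U`. -/
def HolomorphicOnOpen {n : ℕ} (f : ℂ → ℙ ℂ (Fin n → ℂ)) (U : Set ℂ) : Prop :=
  ∀ z ∈ U, HolomorphicNear f z

open scoped Classical in
/-- Holomorphy of a map from the Riemann sphere `ℂ ∪ {∞}`: it is holomorphic in each of the two
standard charts, with coordinates `z` and `1 / z`. -/
def HolomorphicSphere {n : ℕ} (f : OnePoint ℂ → ℙ ℂ (Fin n → ℂ)) : Prop :=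
  HolomorphicOnOpen (fun z : ℂ => f (z : OnePoint ℂ)) Set.univ ∧
  HolomorphicOnOpen
    (fun z : ℂ => f (if z = 0 then OnePoint.infty else ((z⁻¹ : ℂ) : OnePoint ℂ))) Set.univ

open scoped Classical in
/-- The reflection `z ↦ 1 / conj z` from the plane to the Riemann sphere. -/
def reflect (z : ℂ) : OnePoint ℂ :=
  if z = 0 then OnePoint.infty else (((starRingEnd ℂ z)⁻¹ : ℂ) : OnePoint ℂ)

/-! ## Configurations of points on the projective line as binary forms

`V = ℂ²` has basis `x, y`. The form `∑ j, z j * x ^ (d - j) * y ^ j` in `S^d V` has standard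
coordinates `z : Fin (d + 1) → ℂ`. -/

/-- The product `∏ (a i * x + b i * y)` of the linear forms `v i = (a i, b i)`, with `x` set equal
to `1` and `y = X`: the coefficient of `X ^ j` is that of `x ^ (d - j) * y ^ j`. -/
def formPoly {d : ℕ} (v : Fin d → Fin 2 → ℂ) : Polynomial ℂ :=
  ∏ i, (Polynomial.C (v i 0) + Polynomial.C (v i 1) * Polynomial.X)

/-- Standard coordinates on `S^d V` of the product of the linear forms `v i`. -/
def formCoords {d : ℕ} (v : Fin d → Fin 2 → ℂ) : Fin (d + 1) → ℂ :=
  fun j => (formPoly v).coeff j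

theorem formCoords_ne_zero {d : ℕ} (v : Fin d → Fin 2 → ℂ) (hv : ∀ i, v i ≠ 0) :
    formCoords v ≠ 0 := by
  intro h
  have hdeg : (formPoly v).natDegree ≤ d := by
    refine (Polynomial.natDegree_prod_le _ _).trans ?_
    refine (Finset.sum_le_card_nsmul _ _ 1 fun i _ => ?_).trans (by simp)
    rw [add_comm]
    exact Polynomial.natDegree_linear_le
  have h0 : formPoly v = 0 := by
    ext j
    by_cases hj : j < d + 1
    · exact congrFun h ⟨j, hj⟩
    · rw [Polynomial.coeff_zero]
      exact Polynomial.coeff_eq_zero_of_natDegree_lt (by omega)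
  obtain ⟨i, -, hi⟩ := Finset.prod_eq_zero_iff.mp h0
  apply hv i
  have e0 := congrArg (fun p => Polynomial.coeff p 0) hi
  have e1 := congrArg (fun p => Polynomial.coeff p 1) hi
  simp at e0 e1
  funext k
  fin_cases k
  · exact e0
  · exact e1

/-- The identification of unordered `d`-tuples of points of `ℙ V` with points of `ℙ (S^d V)`:
the tuple `[v 1], …, [v d]` goes to `[v 1 * ⋯ * v d]`. -/
def symPoint {d : ℕ} (p : Fin d → ℙ ℂ (Fin 2 → ℂ)) : ℙ ℂ (Fin (d + 1) → ℂ) :=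
  Projectivization.mk ℂ (formCoords fun i => (p i).rep)
    (formCoords_ne_zero _ fun i => (p i).rep_nonzero)

/-- `symPoint` does not depend on the vectors that represent the points. -/
theorem symPoint_mk {d : ℕ} (v : Fin d → Fin 2 → ℂ) (hv : ∀ i, v i ≠ 0) :
    symPoint (fun i => Projectivization.mk ℂ (v i) (hv i)) =
      Projectivization.mk ℂ (formCoords v) (formCoords_ne_zero v hv) := by
  have h : ∀ i, ∃ a : ℂˣ, a • v i = (Projectivization.mk ℂ (v i) (hv i)).rep :=
    fun i => Projectivization.exists_smul_eq_mk_rep ℂ (v i) (hv i)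
  choose a ha using h
  refine (Projectivization.mk_eq_mk_iff' ℂ _ _ _ _).2 ⟨∏ i, (a i : ℂ), ?_⟩
  have hp : formPoly (fun i => (Projectivization.mk ℂ (v i) (hv i)).rep)
      = Polynomial.C (∏ i, (a i : ℂ)) * formPoly v := by
    unfold formPoly
    rw [map_prod, ← Finset.prod_mul_distrib]
    refine Finset.prod_congr rfl fun i _ => ?_
    simp only [← ha i]
    simp [Units.smul_def, mul_add, mul_assoc]
  funext j
  simp only [formCoords, hp, Polynomial.coeff_C_mul, Pi.smul_apply, smul_eq_mul]

/-! ## The configurations -/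

/-- The four types of configuration. -/
inductive Shape
  | triangle
  | tetrahedron
  | octahedron
  | icosahedron

/-- The number of vertices. -/
def Shape.card : Shape → ℕ
  | .triangle => 3
  | .tetrahedron => 4
  | .octahedron => 6
  | .icosahedron => 12

/-- Vertices of an equilateral triangle in a plane through the origin, and of a regular
tetrahedron, octahedron and icosahedron, all centred at the origin (not normalised to lie on the
unit sphere). -/
def Shape.rawVertex : (s : Shape) → Fin s.card → EuclideanSpace ℝ (Fin 3)
  | .triangle => ![!₂[2, 0, 0], !₂[-1, √3, 0], !₂[-1, -√3, 0]]
  | .tetrahedron => ![!₂[1, 1, 1], !₂[1, -1, -1], !₂[-1, 1, -1], !₂[-1, -1, 1]]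
  | .octahedron =>
      ![!₂[1, 0, 0], !₂[-1, 0, 0], !₂[0, 1, 0], !₂[0, -1, 0], !₂[0, 0, 1], !₂[0, 0, -1]]
  | .icosahedron =>
      ![!₂[0, 1, Real.goldenRatio], !₂[0, 1, -Real.goldenRatio],
        !₂[0, -1, Real.goldenRatio], !₂[0, -1, -Real.goldenRatio],
        !₂[1, Real.goldenRatio, 0], !₂[1, -Real.goldenRatio, 0],
        !₂[-1, Real.goldenRatio, 0], !₂[-1, -Real.goldenRatio, 0],
        !₂[Real.goldenRatio, 0, 1], !₂[-Real.goldenRatio, 0, 1],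
        !₂[Real.goldenRatio, 0, -1], !₂[-Real.goldenRatio, 0, -1]]

/-- The vertices on the unit sphere. -/
def Shape.vertex (s : Shape) (i : Fin s.card) : EuclideanSpace ℝ (Fin 3) :=
  (‖s.rawVertex i‖⁻¹ : ℝ) • s.rawVertex i

/-- Homogeneous coordinates of the stereographic projection `(p 0 + i * p 1) / (1 - p 2)` from the
north pole `(0, 0, 1)`, which itself goes to `∞ = [1 : 0]`. -/
def stereoVec (p : EuclideanSpace ℝ (Fin 3)) : Fin 2 → ℂ :=
  if p 2 = 1 then ![1, 0] else ![(p 0 : ℂ) + Complex.I * (p 1 : ℂ), 1 - (p 2 : ℂ)]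

theorem stereoVec_ne_zero (p : EuclideanSpace ℝ (Fin 3)) : stereoVec p ≠ 0 := by
  intro h
  unfold stereoVec at h
  split_ifs at h with hp
  · simpa using congrFun h 0
  · have h1 : (1 : ℂ) - (p 2 : ℂ) = 0 := by simpa using congrFun h 1
    apply hp
    exact_mod_cast (sub_eq_zero.mp h1).symm

/-- The point of `ℙ V` that corresponds to a point of the unit sphere in `ℝ³`. -/
def stereo (p : EuclideanSpace ℝ (Fin 3)) : ℙ ℂ (Fin 2 → ℂ) :=
  Projectivization.mk ℂ (stereoVec p) (stereoVec_ne_zero p)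

/-- The configuration of shape `s` in the position on the sphere given by the orthogonal map `g`:
as `g` varies, these are all equilateral triangles on great circles, and all regular
tetrahedra, octahedra and icosahedra inscribed in the sphere. -/
def config (s : Shape) (g : EuclideanSpace ℝ (Fin 3) ≃ₗᵢ[ℝ] EuclideanSpace ℝ (Fin 3)) :
    Fin s.card → ℙ ℂ (Fin 2 → ℂ) :=
  fun i => stereo (g (s.vertex i))

/-! ## Orbits of a configuration and the involution

Here `SL(2, ℂ)` acts on `ℙ V` in the usual way, and on configurations pointwise. -/

/-- The point `A · C` of `ℙ (S^d V)`. -/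
def orbitPoint {d : ℕ} (C : Fin d → ℙ ℂ (Fin 2 → ℂ)) (A : Matrix.SpecialLinearGroup (Fin 2) ℂ) :
    ℙ ℂ (Fin (d + 1) → ℂ) :=
  symPoint fun i => A • C i

/-- The `SL(2, ℂ)`-orbit `W_C` of `C`. -/
def openOrbit {d : ℕ} (C : Fin d → ℙ ℂ (Fin 2 → ℂ)) : Set (ℙ ℂ (Fin (d + 1) → ℂ)) :=
  Set.range (orbitPoint C)

/-- The orbit closure `X_C`. -/
def orbitClosure {d : ℕ} (C : Fin d → ℙ ℂ (Fin 2 → ℂ)) : Set (ℙ ℂ (Fin (d + 1) → ℂ)) :=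
  closure (openOrbit C)

/-- The `SU(2)`-orbit `L_C` of `C`. -/
def lagrangian {d : ℕ} (C : Fin d → ℙ ℂ (Fin 2 → ℂ)) : Set (ℙ ℂ (Fin (d + 1) → ℂ)) :=
  {p | ∃ A : Matrix.SpecialLinearGroup (Fin 2) ℂ,
    (A : Matrix (Fin 2) (Fin 2) ℂ) ∈ Matrix.specialUnitaryGroup (Fin 2) ℂ ∧ p = orbitPoint C A}

/-- Conjugate-transpose-inverse on `SL(2, ℂ)`. -/
def ddag (A : Matrix.SpecialLinearGroup (Fin 2) ℂ) : Matrix.SpecialLinearGroup (Fin 2) ℂ :=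
  ⟨(A⁻¹ : Matrix.SpecialLinearGroup (Fin 2) ℂ).1.conjTranspose, by
    rw [Matrix.det_conjTranspose, (A⁻¹).2, star_one]⟩

open scoped Classical in
/-- The involution `τ` of `W_C`, `A · C ↦ A^‡ · C`. (Outside `W_C` the value `p` is a dummy;
that the choice of `A` does not matter is a part of the theorem.) -/
def tau {d : ℕ} (C : Fin d → ℙ ℂ (Fin 2 → ℂ)) (p : ℙ ℂ (Fin (d + 1) → ℂ)) :
    ℙ ℂ (Fin (d + 1) → ℂ) :=
  if h : ∃ A, orbitPoint C A = p then orbitPoint C (ddag h.choose) else p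

/-- A holomorphic disc `(D, ∂D) → (X_C, L_C)`: continuous on the closed unit disc `D` and
holomorphic on its interior. -/
structure IsHolomorphicDisc {d : ℕ} (C : Fin d → ℙ ℂ (Fin 2 → ℂ))
    (u : ℂ → ℙ ℂ (Fin (d + 1) → ℂ)) : Prop where
  continuousOn : ContinuousOn u (Metric.closedBall 0 1)
  holomorphic : HolomorphicOnOpen u (Metric.ball 0 1)
  mapsTo : Set.MapsTo u (Metric.closedBall 0 1) (orbitClosure C)
  boundary : Set.MapsTo u (Metric.sphere 0 1) (lagrangian C)

end PlatonicLagrangian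

end

/-!
The antipodal map `z ↦ -1 / conj z` of `ℙ V` is covered by the quaternionic structure of `V = ℂ²`.
It induces an antiholomorphic map `α` of `ℙ (S^d V)`, with `α (A · C) = A^‡ · (antipode of C)`.
Hence `τ` is `α` up to the exchange of `C` with its antipode. That exchange is made by a polynomial
map `Ψ` with `[Ψ] (A · C) = A · (antipode of C)`: the identity for the octahedron and the
icosahedron, which are centrally symmetric, the cubic covariant for the triangle, and the Hessian
for the tetrahedron. So `τ = α ∘ [Ψ]` on `W_C`.

Along a holomorphic curve the coordinates of `Ψ` may acquire a common zero where the curve meets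
`X_C ∖ W_C`, but it can be divided out, so `[Ψ] ∘ u` extends, and `τ ∘ u` with it. For a disc `u`
with boundary on `L_C`, where `τ` is the identity, the extension of `τ ∘ u`, read in the coordinate
`1 / conj z`, continues `u` to a continuous map of the sphere that is holomorphic off the unit
circle, and a circle is removable for continuous maps.
-/

noncomputable section

namespace PlatonicLagrangian

/-! ## Removability of lines and circles for continuous functions -/

section Removability

open Complex Set

variable {E : Type*} [NormedAddCommGroup E] [NormedSpace ℂ E] {f : ℂ → E}

theorem wedgeIntegral_add_wedgeIntegral_eq_zero {z w : ℂ} (hf : ContinuousOn f (Rectangle z w))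
    (hd : ∀ p ∈ Rectangle z w, p.im ∈ Ioo (min z.im w.im) (max z.im w.im) →
      DifferentiableAt ℂ f p) :
    wedgeIntegral z w f + wedgeIntegral w z f = 0 := by
  rw [wedgeIntegral_add_wedgeIntegral_eq]
  refine integral_boundary_rect_eq_zero_of_continuousOn_of_differentiableOn f z w hf fun p hp => ?_
  have hpR : p ∈ Rectangle z w := ⟨Ioo_subset_Icc_self hp.1, Ioo_subset_Icc_self hp.2⟩
  exact (hd p hpR hp.2).differentiableWithinAt

theorem wedgeIntegral_add_wedgeIntegral_split {z w : ℂ} {b : ℝ} (hb : b ∈ uIcc z.im w.im)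
    (hf : ContinuousOn f (Rectangle z w)) :
    wedgeIntegral z w f + wedgeIntegral w z f =
      (wedgeIntegral z ⟨w.re, b⟩ f + wedgeIntegral ⟨w.re, b⟩ z f) +
      (wedgeIntegral ⟨z.re, b⟩ w f + wedgeIntegral w ⟨z.re, b⟩ f) := by
  have hint : ∀ x ∈ uIcc z.re w.re, ∀ y₁ y₂ : ℝ, uIcc y₁ y₂ ⊆ uIcc z.im w.im →
      IntervalIntegrable (fun y : ℝ => f (x + y * I)) MeasureTheory.volume y₁ y₂ := by
    intro x hx y₁ y₂ hs
    refine (hf.comp (by fun_prop) fun y hy => ?_).intervalIntegrable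
    simpa [Rectangle, mem_reProdIm, hx] using hs hy
  have hbot : uIcc z.im b ⊆ uIcc z.im w.im := uIcc_subset_uIcc_left hb
  have htop : uIcc b w.im ⊆ uIcc z.im w.im := uIcc_subset_uIcc_right hb
  simp only [wedgeIntegral_add_wedgeIntegral_eq]
  rw [← intervalIntegral.integral_add_adjacent_intervals
      (hint w.re right_mem_uIcc _ _ hbot) (hint w.re right_mem_uIcc _ _ htop),
    ← intervalIntegral.integral_add_adjacent_intervals
      (hint z.re left_mem_uIcc _ _ hbot) (hint z.re left_mem_uIcc _ _ htop), smul_add, smul_add]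
  abel

theorem isConservativeOn_of_differentiableAt_off_real {U : Set ℂ} (hf : ContinuousOn f U)
    (hd : ∀ z ∈ U, z.im ≠ 0 → DifferentiableAt ℂ f z) : IsConservativeOn f U := by
  intro z w hzw
  rw [← add_eq_zero_iff_eq_neg]
  by_cases h0 : (0 : ℝ) ∈ uIcc z.im w.im
  · have hsub : ∀ y ∈ uIcc z.im w.im, uIcc z.im y ⊆ uIcc z.im w.im ∧
        uIcc y w.im ⊆ uIcc z.im w.im :=
      fun y hy => ⟨uIcc_subset_uIcc_left hy, uIcc_subset_uIcc_right hy⟩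
    have hlow : Rectangle z ⟨w.re, 0⟩ ⊆ U := fun p hp => hzw ⟨hp.1, (hsub 0 h0).1 hp.2⟩
    have hup : Rectangle ⟨z.re, 0⟩ w ⊆ U := fun p hp => hzw ⟨hp.1, (hsub 0 h0).2 hp.2⟩
    have hne : ∀ {y t : ℝ}, t ∈ Ioo (min y 0) (max y 0) → t ≠ 0 := by
      rintro y t ht rfl
      simp only [mem_Ioo, inf_lt_iff, lt_sup_iff, lt_self_iff_false, or_false] at ht
      exact lt_asymm ht.1 ht.2
    rw [wedgeIntegral_add_wedgeIntegral_split h0 (hf.mono hzw),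
      wedgeIntegral_add_wedgeIntegral_eq_zero (hf.mono hlow) fun p hp hpim =>
        hd p (hlow hp) (hne hpim),
      wedgeIntegral_add_wedgeIntegral_eq_zero (hf.mono hup) fun p hp hpim =>
        hd p (hup hp) (hne (y := w.im) (by rwa [min_comm, max_comm])),
      add_zero]
  · exact wedgeIntegral_add_wedgeIntegral_eq_zero (hf.mono hzw) fun p hp _ =>
      hd p (hzw hp) fun hp0 => h0 (hp0 ▸ hp.2)

theorem differentiableAt_of_comp {e : ℂ → ℂ} {a e' : ℂ} (he : HasStrictDerivAt e e' a)
    (he' : e' ≠ 0) (hfe : DifferentiableAt ℂ (f ∘ e) a) : DifferentiableAt ℂ f (e a) := by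
  have hinv : HasStrictDerivAt (he.localInverse e e' a he') e'⁻¹ (e a) := he.to_localInverse he'
  have hinv_apply : he.localInverse e e' a he' (e a) = a :=
    (he.hasStrictFDerivAt_equiv he').localInverse_apply_image
  have hright : ∀ᶠ z in 𝓝 (e a), e (he.localInverse e e' a he' z) = z :=
    (he.hasStrictFDerivAt_equiv he').eventually_right_inverse
  have hcomp : DifferentiableAt ℂ ((f ∘ e) ∘ he.localInverse e e' a he') (e a) :=
    DifferentiableAt.comp _ (by rwa [hinv_apply]) hinv.hasDerivAt.differentiableAt
  exact hcomp.congr_of_eventuallyEq (hright.mono fun z hz => by simp only [Function.comp, hz])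

variable [CompleteSpace E]

theorem differentiableAt_of_continuousAt_of_off_real {z₀ : ℂ}
    (h : ∀ᶠ z in 𝓝 z₀, ContinuousAt f z ∧ (z.im ≠ 0 → DifferentiableAt ℂ f z)) :
    DifferentiableAt ℂ f z₀ := by
  obtain ⟨r, hr, hball⟩ := Metric.eventually_nhds_iff_ball.1 h
  have hc : ContinuousOn f (Metric.ball z₀ r) := fun z hz => (hball z hz).1.continuousWithinAt
  have hcons : IsConservativeOn f (Metric.ball z₀ r) :=
    isConservativeOn_of_differentiableAt_off_real hc fun z hz => (hball z hz).2
  exact ((hcons.isExactOn_ball hc).differentiableOn Metric.isOpen_ball).differentiableAt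
    (Metric.ball_mem_nhds z₀ hr)

theorem differentiableAt_of_continuousAt_of_off_circle {z₀ : ℂ} (hz₀ : ‖z₀‖ = 1)
    (h : ∀ᶠ z in 𝓝 z₀, ContinuousAt f z ∧ (‖z‖ ≠ 1 → DifferentiableAt ℂ f z)) :
    DifferentiableAt ℂ f z₀ := by
  -- `e` straightens the circle: it maps the real line to it, and the complement off it.
  set e : ℂ → ℂ := fun ζ => z₀ * exp (I * ζ) with he
  have he0 : e 0 = z₀ := by simp [he]
  have hed : Differentiable ℂ e := by fun_prop
  have hstrict : HasStrictDerivAt e (z₀ * I) 0 := by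
    simpa using (((hasStrictDerivAt_id (0 : ℂ)).const_mul I).cexp).const_mul z₀
  have hnorm : ∀ ζ, ‖e ζ‖ = 1 → ζ.im = 0 := fun ζ => by simp [he, hz₀, norm_exp]
  have hz₀' : z₀ * I ≠ 0 := mul_ne_zero (norm_ne_zero_iff.1 (by simp [hz₀])) I_ne_zero
  rw [← he0] at h ⊢
  refine differentiableAt_of_comp hstrict hz₀' (differentiableAt_of_continuousAt_of_off_real ?_)
  filter_upwards [hed.continuous.continuousAt.eventually h] with ζ hζ
  exact ⟨hζ.1.comp hed.continuous.continuousAt,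
    fun hi => (hζ.2 fun h1 => hi (hnorm ζ h1)).comp ζ (hed ζ)⟩

end Removability

/-! ## Holomorphic maps to projective space -/

theorem isOpenQuotientMap_projectivization_mk {n : ℕ} : IsOpenQuotientMap
    (fun v : {v : Fin n → ℂ // v ≠ 0} => Projectivization.mk ℂ v.1 v.2) := by
  refine IsOpenQuotientMap.of_isOpenMap_isQuotientMap (fun O hO => ?_)
    ⟨⟨rfl⟩, fun p => ⟨⟨p.rep, p.rep_nonzero⟩, p.mk_rep⟩⟩
  let scale (a : ℂˣ) (v : {v : Fin n → ℂ // v ≠ 0}) : {v : Fin n → ℂ // v ≠ 0} :=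
    ⟨a • v.1, (smul_ne_zero_iff_ne a).2 v.2⟩
  have hsat : (fun v : {v : Fin n → ℂ // v ≠ 0} => Projectivization.mk ℂ v.1 v.2) ⁻¹'
      ((fun v : {v : Fin n → ℂ // v ≠ 0} => Projectivization.mk ℂ v.1 v.2) '' O) =
      ⋃ a : ℂˣ, scale a ⁻¹' O := by
    ext v
    simp only [Set.mem_preimage, Set.mem_image, Set.mem_iUnion, Projectivization.mk_eq_mk_iff]
    constructor
    · rintro ⟨x, hx, a, ha⟩
      exact ⟨a, by rwa [show scale a v = x from Subtype.ext ha]⟩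
    · rintro ⟨a, ha⟩
      exact ⟨scale a v, ha, a, rfl⟩
  rw [isOpen_coinduced, hsat]
  refine isOpen_iUnion fun a => hO.preimage (Continuous.subtype_mk ?_ _)
  exact continuous_subtype_val.const_smul (a : ℂ)

section ToProj

variable {n : ℕ} [NeZero n]

open scoped Classical in
/-- The point `[v]` of projective space, as a total function of the vector `v` of its homogeneous
coordinates; its value at `v = 0` is an arbitrary point. -/
def toProj (v : Fin n → ℂ) : ℙ ℂ (Fin n → ℂ) :=
  if hv : v ≠ 0 then Projectivization.mk ℂ v hv else Classical.arbitrary _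

theorem toProj_of_ne_zero {v : Fin n → ℂ} (hv : v ≠ 0) : toProj v = Projectivization.mk ℂ v hv :=
  dif_pos hv

theorem toProj_rep (p : ℙ ℂ (Fin n → ℂ)) : toProj p.rep = p := by
  rw [toProj_of_ne_zero p.rep_nonzero, p.mk_rep]

theorem toProj_smul {c : ℂ} (hc : c ≠ 0) (v : Fin n → ℂ) : toProj (c • v) = toProj v := by
  by_cases hv : v = 0
  · simp [hv]
  · rw [toProj_of_ne_zero hv, toProj_of_ne_zero (smul_ne_zero hc hv)]
    exact (Projectivization.mk_eq_mk_iff' ℂ _ _ _ _).2 ⟨c, rfl⟩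

theorem exists_rep_toProj {v : Fin n → ℂ} (hv : v ≠ 0) :
    ∃ c : ℂ, c ≠ 0 ∧ (toProj v).rep = c • v := by
  rw [toProj_of_ne_zero hv]
  obtain ⟨c, hc⟩ := Projectivization.exists_smul_eq_mk_rep ℂ v hv
  exact ⟨c, c.ne_zero, hc.symm⟩

theorem nhds_toProj {v : Fin n → ℂ} (hv : v ≠ 0) : 𝓝 (toProj v) = Filter.map toProj (𝓝 v) := by
  have hmk : (fun w : {w : Fin n → ℂ // w ≠ 0} => Projectivization.mk ℂ w.1 w.2) =
      toProj ∘ Subtype.val := funext fun w => (toProj_of_ne_zero w.2).symm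
  rw [toProj_of_ne_zero hv,
    ← isOpenQuotientMap_projectivization_mk.map_nhds_eq (⟨v, hv⟩ : {w : Fin n → ℂ // w ≠ 0}), hmk,
    ← Filter.map_map, map_nhds_subtype_coe_eq_nhds (p := (· ≠ 0)) hv (isOpen_ne.mem_nhds hv)]

theorem continuousAt_toProj {v : Fin n → ℂ} (hv : v ≠ 0) : ContinuousAt toProj v :=
  (nhds_toProj hv).ge

end ToProj

section HolomorphicMaps

variable {n : ℕ} [NeZero n] {f g : ℂ → ℙ ℂ (Fin n → ℂ)} {z : ℂ}

theorem holomorphicNear_iff : HolomorphicNear f z ↔ ∃ F : ℂ → Fin n → ℂ,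
    AnalyticAt ℂ F z ∧ F z ≠ 0 ∧ ∀ᶠ y in 𝓝 z, f y = toProj (F y) := by
  constructor
  · rintro ⟨F, hF⟩
    refine ⟨F, Complex.analyticAt_iff_eventually_differentiableAt.2 (hF.mono fun y hy => hy.1),
      hF.self_of_nhds.2.1, hF.mono fun y ⟨_, hy0, hy⟩ => hy.trans (toProj_of_ne_zero hy0).symm⟩
  · rintro ⟨F, hF, hF0, hf⟩
    refine ⟨F, ?_⟩
    filter_upwards [Complex.analyticAt_iff_eventually_differentiableAt.1 hF, hf,
      hF.continuousAt.eventually_ne hF0] with y hdiff hy hy0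
    exact ⟨hdiff, hy0, hy.trans (toProj_of_ne_zero hy0)⟩

theorem HolomorphicNear.continuousAt (hf : HolomorphicNear f z) : ContinuousAt f z := by
  obtain ⟨F, hF, hF0, hfF⟩ := holomorphicNear_iff.1 hf
  exact ((continuousAt_toProj hF0).comp hF.continuousAt).congr (hfF.mono fun _ hy => hy.symm)

theorem HolomorphicNear.congr (hf : HolomorphicNear f z) (hfg : ∀ᶠ y in 𝓝 z, g y = f y) :
    HolomorphicNear g z := by
  obtain ⟨F, hF, hF0, hfF⟩ := holomorphicNear_iff.1 hf
  refine holomorphicNear_iff.2 ⟨F, hF, hF0, ?_⟩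
  filter_upwards [hfF, hfg] with y hy hy' using hy'.trans hy

theorem HolomorphicNear.comp {φ : ℂ → ℂ} (hf : HolomorphicNear f (φ z)) (hφ : AnalyticAt ℂ φ z) :
    HolomorphicNear (fun y => f (φ y)) z := by
  obtain ⟨F, hF, hF0, hfF⟩ := holomorphicNear_iff.1 hf
  exact holomorphicNear_iff.2 ⟨F ∘ φ, hF.comp hφ, hF0, hφ.continuousAt.eventually hfF⟩

/-- Affine coordinates on the chart of projective space where the homogeneous coordinate `k` does
not vanish, as vectors whose `k`-th entry is `1`; off the chart the value is `0`. -/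
def affineCoords (k : Fin n) (p : ℙ ℂ (Fin n → ℂ)) : Fin n → ℂ :=
  (p.rep k)⁻¹ • p.rep

variable {k : Fin n}

theorem affineCoords_toProj {v : Fin n → ℂ} (hv : v ≠ 0) :
    affineCoords k (toProj v) = (v k)⁻¹ • v := by
  obtain ⟨c, hc, hrep⟩ := exists_rep_toProj hv
  rw [affineCoords, hrep, Pi.smul_apply, smul_eq_mul, mul_inv, smul_smul, mul_right_comm,
    inv_mul_cancel₀ hc, one_mul]

theorem toProj_affineCoords {p : ℙ ℂ (Fin n → ℂ)} (hp : p.rep k ≠ 0) :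
    toProj (affineCoords k p) = p := by
  rw [affineCoords, toProj_smul (inv_ne_zero hp), toProj_rep]

theorem rep_toProj_apply_eq_zero {v : Fin n → ℂ} (hv : v ≠ 0) :
    (toProj v).rep k = 0 ↔ v k = 0 := by
  obtain ⟨c, hc, hrep⟩ := exists_rep_toProj hv
  simp [hrep, hc]

theorem eventually_rep_apply_ne_zero {p : ℙ ℂ (Fin n → ℂ)} (hp : p.rep k ≠ 0) :
    ∀ᶠ q in 𝓝 p, q.rep k ≠ 0 := by
  have hk : ∀ᶠ v in 𝓝 p.rep, v k ≠ 0 := (continuous_apply k).continuousAt.eventually_ne hp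
  rw [← toProj_rep p, nhds_toProj p.rep_nonzero, Filter.eventually_map]
  filter_upwards [hk, isOpen_ne.mem_nhds p.rep_nonzero] with v hvk hv
  rwa [Ne, rep_toProj_apply_eq_zero hv]

theorem continuousAt_affineCoords {p : ℙ ℂ (Fin n → ℂ)} (hp : p.rep k ≠ 0) :
    ContinuousAt (affineCoords k) p := by
  have hcont : ContinuousAt (fun v : Fin n → ℂ => (v k)⁻¹ • v) p.rep :=
    ((continuous_apply k).continuousAt.inv₀ hp).smul continuousAt_id
  rw [← toProj_rep p, ContinuousAt, nhds_toProj p.rep_nonzero, Filter.tendsto_map'_iff,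
    affineCoords_toProj p.rep_nonzero]
  refine hcont.tendsto.congr' ?_
  filter_upwards [isOpen_ne.mem_nhds p.rep_nonzero] with v hv
  exact (affineCoords_toProj hv).symm

theorem HolomorphicNear.differentiableAt_affineCoords (hf : HolomorphicNear f z)
    (hk : (f z).rep k ≠ 0) : DifferentiableAt ℂ (fun y => affineCoords k (f y)) z := by
  obtain ⟨F, hF, hF0, hfF⟩ := holomorphicNear_iff.1 hf
  have hFk : F z k ≠ 0 := by rwa [Ne, ← rep_toProj_apply_eq_zero hF0, ← hfF.self_of_nhds]
  have hdiff : DifferentiableAt ℂ (fun y => (F y k)⁻¹ • F y) z :=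
    ((differentiableAt_pi.1 hF.differentiableAt k).inv hFk).smul hF.differentiableAt
  refine hdiff.congr_of_eventuallyEq ?_
  filter_upwards [hfF, hF.continuousAt.eventually_ne hF0] with y hy hy0
  rw [hy, affineCoords_toProj hy0]

theorem holomorphicNear_of_continuousAt_of_off_circle
    (h : ∀ᶠ y in 𝓝 z, ContinuousAt f y ∧ (‖y‖ ≠ 1 → HolomorphicNear f y)) :
    HolomorphicNear f z := by
  obtain ⟨k, hk⟩ := Function.ne_iff.1 (f z).rep_nonzero
  have hchart : ∀ᶠ y in 𝓝 z, (f y).rep k ≠ 0 :=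
    h.self_of_nhds.1.eventually (eventually_rep_apply_ne_zero hk)
  have hoff : ∀ᶠ y in 𝓝 z, ContinuousAt (fun y => affineCoords k (f y)) y ∧
      (‖y‖ ≠ 1 → DifferentiableAt ℂ (fun y => affineCoords k (f y)) y) := by
    filter_upwards [h, hchart] with y hy hyk
    exact ⟨(continuousAt_affineCoords hyk).comp hy.1,
      fun hy1 => (hy.2 hy1).differentiableAt_affineCoords hyk⟩
  have hdiff : ∀ᶠ y in 𝓝 z, DifferentiableAt ℂ (fun y => affineCoords k (f y)) y := by
    filter_upwards [hoff.eventually_nhds] with y hy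
    by_cases hy1 : ‖y‖ = 1
    · exact differentiableAt_of_continuousAt_of_off_circle hy1 hy
    · exact hy.self_of_nhds.2 hy1
  exact holomorphicNear_iff.2 ⟨fun y => affineCoords k (f y),
    Complex.analyticAt_iff_eventually_differentiableAt.2 hdiff,
    smul_ne_zero (inv_ne_zero hk) (f z).rep_nonzero,
    hchart.mono fun y hy => (toProj_affineCoords hy).symm⟩

end HolomorphicMaps

/-! ## Gluing two discs to a sphere -/

section Gluing

/-- The map that is `f` on the closed unit disc and `g` in the coordinate `1 / z` outside it. -/
def glue {X : Type*} (f g : ℂ → X) (z : ℂ) : X :=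
  if ‖z‖ ≤ 1 then f z else g z⁻¹

theorem continuous_glue {X : Type*} [TopologicalSpace X] {f g : ℂ → X}
    (hf : ContinuousOn f (Metric.closedBall 0 1)) (hg : ContinuousOn g (Metric.closedBall 0 1))
    (hfg : ∀ z, ‖z‖ = 1 → f z = g z⁻¹) : Continuous (glue f g) := by
  refine continuous_if_le continuous_norm continuous_const ?_ ?_ hfg
  · simpa [Metric.closedBall, dist_zero_right] using hf
  · refine hg.comp (continuousOn_inv₀.mono ?_) ?_
    · rintro z (hz : 1 ≤ ‖z‖) rfl
      simp at hz
      linarith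
    · intro z (hz : 1 ≤ ‖z‖)
      simpa using inv_le_one_of_one_le₀ hz

theorem glue_inv {X : Type*} {f g : ℂ → X} (hfg : ∀ z, ‖z‖ = 1 → f z = g z⁻¹) {z : ℂ}
    (hz : z ≠ 0) : glue f g z⁻¹ = glue g f z := by
  have hz' : 0 < ‖z‖ := norm_pos_iff.2 hz
  unfold glue
  simp only [norm_inv, inv_le_one₀ hz', inv_inv]
  rcases lt_trichotomy ‖z‖ 1 with h | h | h
  · rw [if_neg h.not_ge, if_pos h.le]
  · rw [if_pos h.ge, if_pos h.le, hfg _ (by rw [norm_inv, h, inv_one]), inv_inv]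
  · rw [if_pos h.le, if_neg h.not_ge]

variable {n : ℕ} [NeZero n] {f g : ℂ → ℙ ℂ (Fin n → ℂ)}

theorem holomorphicOnOpen_glue (hf : ContinuousOn f (Metric.closedBall 0 1))
    (hf' : HolomorphicOnOpen f (Metric.ball 0 1)) (hg : ContinuousOn g (Metric.closedBall 0 1))
    (hg' : HolomorphicOnOpen g (Metric.ball 0 1)) (hfg : ∀ z, ‖z‖ = 1 → f z = g z⁻¹) :
    HolomorphicOnOpen (glue f g) Set.univ := by
  refine fun z _ => holomorphicNear_of_continuousAt_of_off_circle (.of_forall fun y => ?_)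
  refine ⟨(continuous_glue hf hg hfg).continuousAt, fun hy => ?_⟩
  rcases hy.lt_or_gt with hy | hy
  · refine (hf' y (by simpa using hy)).congr ?_
    filter_upwards [continuous_norm.continuousAt.eventually_lt continuousAt_const hy] with x hx
    exact if_pos hx.le
  · have hy0 : y ≠ 0 := norm_pos_iff.1 (one_pos.trans hy)
    have hinv : y⁻¹ ∈ Metric.ball (0 : ℂ) 1 := by simpa using inv_lt_one_of_one_lt₀ hy
    refine ((hg' _ hinv).comp (analyticAt_inv hy0)).congr ?_
    filter_upwards [continuousAt_const.eventually_lt continuous_norm.continuousAt hy] with x hx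
    exact if_neg hx.not_ge

open scoped Classical in
theorem exists_holomorphicSphere (hf : ContinuousOn f (Metric.closedBall 0 1))
    (hf' : HolomorphicOnOpen f (Metric.ball 0 1)) (hg : ContinuousOn g (Metric.closedBall 0 1))
    (hg' : HolomorphicOnOpen g (Metric.ball 0 1)) (hfg : ∀ z, ‖z‖ = 1 → f z = g z⁻¹) :
    ∃ w : OnePoint ℂ → ℙ ℂ (Fin n → ℂ), HolomorphicSphere w ∧
      (∀ z ∈ Metric.closedBall (0 : ℂ) 1, w z = f z) ∧
      ∀ z ∈ Metric.closedBall (0 : ℂ) 1,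
        w (if z = 0 then OnePoint.infty else ((z⁻¹ : ℂ) : OnePoint ℂ)) = g z := by
  let w : OnePoint ℂ → ℙ ℂ (Fin n → ℂ) := fun x => x.elim (g 0) (glue f g)
  have hgf : ∀ z, ‖z‖ = 1 → g z = f z⁻¹ := fun z hz => by
    rw [hfg z⁻¹ (by rw [norm_inv, hz, inv_one]), inv_inv]
  have hw : ∀ z : ℂ, w (if z = 0 then OnePoint.infty else ((z⁻¹ : ℂ) : OnePoint ℂ)) =
      glue g f z := by
    intro z
    split_ifs with hz
    · simp [w, glue, hz]
    · exact glue_inv hfg hz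
  refine ⟨w, ⟨holomorphicOnOpen_glue hf hf' hg hg' hfg, ?_⟩, fun z hz => ?_, fun z hz => ?_⟩
  · simpa only [hw] using holomorphicOnOpen_glue hg hg' hf hf' hgf
  · exact if_pos (mem_closedBall_zero_iff.1 hz)
  · rw [hw]
    exact if_pos (mem_closedBall_zero_iff.1 hz)

end Gluing

/-! ## Rational maps along holomorphic curves -/

/-- A holomorphic map of coordinate spaces that is homogeneous of degree `m`, the lift of a rational
map of projective spaces. -/
structure IsHomogeneousMap {n k : ℕ} (Ψ : (Fin n → ℂ) → Fin k → ℂ) (m : ℕ) : Prop where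
  differentiable : Differentiable ℂ Ψ
  map_smul : ∀ (c : ℂ) (v : Fin n → ℂ), Ψ (c • v) = c ^ m • Ψ v

/-- The rational map of projective spaces with lift `Ψ`; it takes an arbitrary value on its
indeterminacy locus `{p | Ψ p.rep = 0}`. -/
def ratMap {n k : ℕ} [NeZero k] (Ψ : (Fin n → ℂ) → Fin k → ℂ) (p : ℙ ℂ (Fin n → ℂ)) :
    ℙ ℂ (Fin k → ℂ) :=
  toProj (Ψ p.rep)

namespace IsHomogeneousMap

variable {n k m : ℕ} [NeZero n] {Ψ : (Fin n → ℂ) → Fin k → ℂ} {u : ℂ → ℙ ℂ (Fin n → ℂ)} {z : ℂ}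

theorem rep_toProj_eq_zero (h : IsHomogeneousMap Ψ m) {v : Fin n → ℂ} (hv : v ≠ 0) :
    Ψ (toProj v).rep = 0 ↔ Ψ v = 0 := by
  obtain ⟨c, hc, hrep⟩ := exists_rep_toProj hv
  rw [hrep, h.map_smul, smul_eq_zero_iff_right (pow_ne_zero _ hc)]

theorem eventually_rep_ne_zero (h : IsHomogeneousMap Ψ m) {p : ℙ ℂ (Fin n → ℂ)}
    (hp : Ψ p.rep ≠ 0) : ∀ᶠ q in 𝓝 p, Ψ q.rep ≠ 0 := by
  have hΨ : ∀ᶠ v in 𝓝 p.rep, Ψ v ≠ 0 := h.differentiable.continuous.continuousAt.eventually_ne hp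
  rw [← toProj_rep p, nhds_toProj p.rep_nonzero, Filter.eventually_map]
  filter_upwards [hΨ, isOpen_ne.mem_nhds p.rep_nonzero] with v hΨv hv
  rwa [Ne, h.rep_toProj_eq_zero hv]

variable [NeZero k]

theorem ratMap_toProj (h : IsHomogeneousMap Ψ m) {v : Fin n → ℂ} (hv : v ≠ 0) :
    ratMap Ψ (toProj v) = toProj (Ψ v) := by
  obtain ⟨c, hc, hrep⟩ := exists_rep_toProj hv
  rw [ratMap, hrep, h.map_smul, toProj_smul (pow_ne_zero _ hc)]

theorem continuousAt_ratMap (h : IsHomogeneousMap Ψ m) {p : ℙ ℂ (Fin n → ℂ)}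
    (hp : Ψ p.rep ≠ 0) : ContinuousAt (ratMap Ψ) p := by
  have hcont : ContinuousAt (fun v => toProj (Ψ v)) p.rep :=
    (continuousAt_toProj hp).comp h.differentiable.continuous.continuousAt
  rw [← toProj_rep p, ContinuousAt, nhds_toProj p.rep_nonzero, Filter.tendsto_map'_iff,
    h.ratMap_toProj p.rep_nonzero]
  refine hcont.tendsto.congr' ?_
  filter_upwards [isOpen_ne.mem_nhds p.rep_nonzero] with v hv
  exact (h.ratMap_toProj hv).symm

theorem exists_analyticAt_lift (h : IsHomogeneousMap Ψ m) (hu : HolomorphicNear u z) :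
    ∃ F : ℂ → Fin k → ℂ, AnalyticAt ℂ F z ∧
      ∀ᶠ y in 𝓝 z, (Ψ (u y).rep = 0 ↔ F y = 0) ∧ ratMap Ψ (u y) = toProj (F y) := by
  obtain ⟨F, hF, hF0, huF⟩ := holomorphicNear_iff.1 hu
  refine ⟨Ψ ∘ F, ?_, ?_⟩
  · rw [Complex.analyticAt_iff_eventually_differentiableAt] at hF ⊢
    exact hF.mono fun y hy => (h.differentiable (F y)).comp y hy
  · filter_upwards [huF, hF.continuousAt.eventually_ne hF0] with y hy hy0
    rw [hy]
    exact ⟨h.rep_toProj_eq_zero hy0, h.ratMap_toProj hy0⟩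

theorem eventually_eq_zero_or_eventually_ne_zero (h : IsHomogeneousMap Ψ m)
    (hu : HolomorphicNear u z) :
    (∀ᶠ y in 𝓝 z, Ψ (u y).rep = 0) ∨ ∀ᶠ y in 𝓝[≠] z, Ψ (u y).rep ≠ 0 := by
  obtain ⟨F, hF, huF⟩ := h.exists_analyticAt_lift hu
  refine hF.eventually_eq_zero_or_eventually_ne_zero.imp (fun h0 => ?_) fun hne => ?_
  · filter_upwards [h0, huF] with y hy hyF using hyF.1.2 hy
  · filter_upwards [hne, nhdsWithin_le_nhds huF] with y hy hyF using mt hyF.1.1 hy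

theorem frequently_ne_zero (h : IsHomogeneousMap Ψ m) {U : Set ℂ} (hU : IsPreconnected U)
    (hu : HolomorphicOnOpen u U) {z₀ : ℂ} (hz₀ : z₀ ∈ U) (hne : Ψ (u z₀).rep ≠ 0) :
    ∀ z ∈ U, ∃ᶠ y in 𝓝 z, Ψ (u y).rep ≠ 0 := by
  set Z : Set ℂ := {z | ∀ᶠ y in 𝓝 z, Ψ (u y).rep = 0} with hZ
  have hclosed : closure Z ∩ U ⊆ Z := by
    rintro z ⟨hzZ, hzU⟩
    refine (h.eventually_eq_zero_or_eventually_ne_zero (hu z hzU)).resolve_right fun hne => ?_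
    by_cases hz : z ∈ Z
    · obtain ⟨y, hy, hy'⟩ := (hne.and (nhdsWithin_le_nhds hz)).exists
      exact hy hy'
    · have hfreq : ∃ᶠ y in 𝓝[≠] z, y ∈ Z :=
        frequently_nhdsWithin_iff.2 ((mem_closure_iff_frequently.1 hzZ).mono
          fun y hy => ⟨hy, fun hyz => hz (hyz ▸ hy)⟩)
      obtain ⟨y, hyZ, hy⟩ := (hfreq.and_eventually hne).exists
      exact hy hyZ.self_of_nhds
  intro z hz hzZ
  have hUZ : U ⊆ Z := hU.subset_of_closure_inter_subset isOpen_setOfPred_eventually_nhds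
    ⟨z, hz, by simpa [hZ] using hzZ⟩ hclosed
  exact hne (hUZ hz₀).self_of_nhds

theorem exists_toProj_eq_ratMap (h : IsHomogeneousMap Ψ m) (hu : HolomorphicNear u z)
    (hne : ∃ᶠ y in 𝓝 z, Ψ (u y).rep ≠ 0) :
    ∃ G : ℂ → Fin k → ℂ, AnalyticAt ℂ G z ∧ G z ≠ 0 ∧
      ∀ᶠ y in 𝓝 z, Ψ (u y).rep ≠ 0 → ratMap Ψ (u y) = toProj (G y) := by
  obtain ⟨F, hF, huF⟩ := h.exists_analyticAt_lift hu
  have hF0 : ¬∀ᶠ y in 𝓝 z, F y = 0 := fun hF0 => hne <| by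
    filter_upwards [hF0, huF] with y hy hyF using not_not.2 (hyF.1.2 hy)
  obtain ⟨r, G, hG, hG0, hFG⟩ := hF.exists_eventuallyEq_pow_smul_nonzero_iff.2 hF0
  refine ⟨G, hG, hG0, ?_⟩
  filter_upwards [huF, hFG] with y hyF hyG hy
  rw [Ne, hyF.1, hyG] at hy
  rw [hyF.2, hyG, toProj_smul fun h0 => hy (by rw [h0, zero_smul])]

open scoped Classical in
theorem exists_holomorphicOnOpen_eq_ratMap (h : IsHomogeneousMap Ψ m) {U : Set ℂ}
    (hu : HolomorphicOnOpen u U) (hne : ∀ z ∈ U, ∃ᶠ y in 𝓝 z, Ψ (u y).rep ≠ 0) :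
    ∃ v : ℂ → ℙ ℂ (Fin k → ℂ), HolomorphicOnOpen v U ∧
      ∀ z, Ψ (u z).rep ≠ 0 → v z = ratMap Ψ (u z) := by
  choose! G hG hG0 hGu using fun z hz => h.exists_toProj_eq_ratMap (hu z hz) (hne z hz)
  set v : ℂ → ℙ ℂ (Fin k → ℂ) := fun z => if z ∈ U then toProj (G z z) else ratMap Ψ (u z) with hv
  have hvu : ∀ z, Ψ (u z).rep ≠ 0 → v z = ratMap Ψ (u z) := by
    intro z hz
    by_cases hzU : z ∈ U
    · simp only [hv, if_pos hzU, (hGu z hzU).self_of_nhds hz]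
    · exact if_neg hzU
  refine ⟨v, fun z hz => holomorphicNear_iff.2 ⟨G z, hG z hz, hG0 z hz, ?_⟩, hvu⟩
  have hpunctured : ∀ᶠ y in 𝓝[≠] z, Ψ (u y).rep ≠ 0 :=
    (h.eventually_eq_zero_or_eventually_ne_zero (hu z hz)).resolve_left
      fun h0 => hne z hz (h0.mono fun _ hy => not_not.2 hy)
  filter_upwards [hGu z hz, eventually_nhdsWithin_iff.1 hpunctured] with y hyG hyne
  rcases eq_or_ne y z with rfl | hyz
  · exact if_pos hz
  · rw [hvu y (hyne hyz), hyG (hyne hyz)]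

end IsHomogeneousMap

/-! ## The antipodal map -/

section Antipode

open scoped ComplexConjugate Matrix

variable {n : ℕ}

/-- The antilinear map of `ℂⁿ` that covers the antipodal map: on `ℂ²` it is the quaternionic
structure `(a, b) ↦ (-conj b, conj a)`, and on coordinates of binary forms of degree `n - 1` it is
the map induced by that structure. -/
def quat : (Fin n → ℂ) →ₛₗ[starRingEnd ℂ] (Fin n → ℂ) where
  toFun v k := (-1) ^ (k.rev : ℕ) * conj (v k.rev)
  map_add' v w := by
    funext k
    simp only [Pi.add_apply, map_add, mul_add]
  map_smul' c v := by
    funext k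
    simp only [Pi.smul_apply, smul_eq_mul, map_mul, mul_left_comm]

theorem quat_apply (v : Fin n → ℂ) (k : Fin n) :
    quat v k = (-1) ^ (k.rev : ℕ) * conj (v k.rev) := rfl

theorem quat_quat (v : Fin n → ℂ) : quat (quat v) = (-1 : ℂ) ^ (n - 1) • v := by
  funext k
  have hk : (k.rev : ℕ) + k = n - 1 := by have := k.2; rw [Fin.val_rev]; omega
  rw [quat_apply, quat_apply, map_mul, Complex.conj_conj, Fin.rev_rev, map_pow, map_neg, map_one,
    ← mul_assoc, ← pow_add, hk, Pi.smul_apply, smul_eq_mul]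

theorem quat_injective : Function.Injective (quat : (Fin n → ℂ) → Fin n → ℂ) := by
  intro v w h
  have h' : quat (quat v) = quat (quat w) := congrArg quat h
  rw [quat_quat, quat_quat] at h'
  exact smul_right_injective _ (pow_ne_zero _ (neg_ne_zero.2 one_ne_zero)) h'

theorem quat_ne_zero {v : Fin n → ℂ} (hv : v ≠ 0) : quat v ≠ 0 :=
  (map_ne_zero_iff quat quat_injective).2 hv

theorem continuous_quat : Continuous (quat : (Fin n → ℂ) → Fin n → ℂ) :=
  continuous_pi fun k =>
    continuous_const.mul (Complex.continuous_conj.comp (continuous_apply k.rev))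

theorem differentiableAt_quat_comp_conj {F : ℂ → Fin n → ℂ} {z : ℂ}
    (hF : DifferentiableAt ℂ F (conj z)) : DifferentiableAt ℂ (fun y => quat (F (conj y))) z := by
  refine differentiableAt_pi.2 fun k => DifferentiableAt.const_mul ?_ _
  have h := (differentiableAt_pi.1 hF k.rev).star_star
  rwa [← starRingEnd_apply (conj z), Complex.conj_conj] at h

/-- The antipodal map of projective space, which exists since `quat` is antilinear. -/
def antipode : ℙ ℂ (Fin n → ℂ) → ℙ ℂ (Fin n → ℂ) :=
  Projectivization.map quat quat_injective

theorem continuous_antipode :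
    Continuous (antipode : ℙ ℂ (Fin n → ℂ) → ℙ ℂ (Fin n → ℂ)) := by
  refine isOpenQuotientMap_projectivization_mk.isQuotientMap.continuous_iff.2 ?_
  exact isOpenQuotientMap_projectivization_mk.continuous.comp
    ((continuous_quat.comp continuous_subtype_val).subtype_mk fun v => quat_ne_zero v.2)

theorem antipode_antipode (p : ℙ ℂ (Fin n → ℂ)) : antipode (antipode p) = p := by
  induction p using Projectivization.ind with
  | h v hv =>
    refine (Projectivization.mk_eq_mk_iff' ℂ _ _ _ _).2 ⟨(-1) ^ (n - 1), ?_⟩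
    exact (quat_quat v).symm

theorem HolomorphicNear.antipode_comp_conj {f : ℂ → ℙ ℂ (Fin n → ℂ)} {z : ℂ}
    (hf : HolomorphicNear f (conj z)) : HolomorphicNear (fun y => antipode (f (conj y))) z := by
  obtain ⟨F, hF⟩ := hf
  refine ⟨fun y => quat (F (conj y)), ?_⟩
  filter_upwards [Complex.continuous_conj.continuousAt.eventually hF] with y ⟨hdiff, hy0, hy⟩
  exact ⟨differentiableAt_quat_comp_conj hdiff, quat_ne_zero hy0, by rw [hy]; rfl⟩

theorem antipode_toProj [NeZero n] {v : Fin n → ℂ} (hv : v ≠ 0) :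
    antipode (toProj v) = toProj (quat v) := by
  rw [toProj_of_ne_zero hv, toProj_of_ne_zero (quat_ne_zero hv)]
  rfl

end Antipode

/-! ## Products of linear forms -/

section BinaryForms

open Polynomial
open scoped ComplexConjugate Matrix

theorem natDegree_prod_le_card {R ι : Type*} [CommSemiring R] {f : ι → R[X]} (s : Finset ι)
    (hf : ∀ i, (f i).natDegree ≤ 1) : (∏ i ∈ s, f i).natDegree ≤ s.card :=
  (natDegree_prod_le _ _).trans <|
    (Finset.sum_le_card_nsmul s _ 1 fun i _ => hf i).trans_eq (by simp)

theorem reflect_prod {R ι : Type*} [CommSemiring R] {f : ι → R[X]} (s : Finset ι)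
    (hf : ∀ i, (f i).natDegree ≤ 1) :
    (∏ i ∈ s, f i).reflect s.card = ∏ i ∈ s, (f i).reflect 1 := by
  classical
  induction s using Finset.induction_on with
  | empty => simp
  | insert a s ha ih =>
    rw [Finset.prod_insert ha, Finset.prod_insert ha, Finset.card_insert_of_notMem ha, add_comm,
      reflect_mul _ _ (hf a) (natDegree_prod_le_card s hf), ih]

theorem reflect_one_linear {R : Type*} [CommSemiring R] (a b : R) :
    (C a + C b * X).reflect 1 = C b + C a * X := by
  rw [reflect_add, reflect_C, ← pow_one (X : R[X]), reflect_C_mul_X_pow, revAt_le le_rfl, pow_one,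
    tsub_self, pow_zero, mul_one, add_comm]

variable {d : ℕ}

theorem formPoly_quat (v : Fin d → Fin 2 → ℂ) :
    formPoly (fun i => quat (v i)) =
      (((formPoly v).map (starRingEnd ℂ)).comp (C (-1) * X)).reflect d := by
  have hdeg : ∀ i, (C (conj (v i 0)) + C (-conj (v i 1)) * X).natDegree ≤ 1 := fun i => by
    rw [add_comm]
    exact natDegree_linear_le
  have hcomp : ((formPoly v).map (starRingEnd ℂ)).comp (C (-1) * X) =
      ∏ i, (C (conj (v i 0)) + C (-conj (v i 1)) * X) := by
    simp [formPoly, Polynomial.map_prod, prod_comp]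
  have hreflect := reflect_prod Finset.univ hdeg
  rw [Finset.card_fin] at hreflect
  rw [hcomp, hreflect]
  refine Finset.prod_congr rfl fun i _ => ?_
  rw [reflect_one_linear]
  simp [quat_apply]

theorem formCoords_quat (v : Fin d → Fin 2 → ℂ) :
    formCoords (fun i => quat (v i)) = quat (formCoords v) := by
  funext k
  rw [formCoords, formPoly_quat, coeff_reflect, revAt_le (Nat.le_of_lt_succ k.2),
    comp_C_mul_X_coeff, coeff_map, mul_comm, quat_apply, Fin.val_rev, formCoords, Fin.val_rev,
    Nat.add_sub_add_right]

theorem symPoint_eq_toProj (p : Fin d → ℙ ℂ (Fin 2 → ℂ)) :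
    symPoint p = toProj (formCoords fun i => (p i).rep) :=
  (toProj_of_ne_zero _).symm

theorem symPoint_toProj {v : Fin d → Fin 2 → ℂ} (hv : ∀ i, v i ≠ 0) :
    symPoint (fun i => toProj (v i)) = toProj (formCoords v) := by
  simp only [toProj_of_ne_zero (hv _)]
  rw [symPoint_mk, toProj_of_ne_zero]

theorem symPoint_comp_perm (σ : Equiv.Perm (Fin d)) (p : Fin d → ℙ ℂ (Fin 2 → ℂ)) :
    symPoint (p ∘ σ) = symPoint p := by
  have hform : formPoly (fun i => ((p ∘ σ) i).rep) = formPoly fun i => (p i).rep :=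
    Equiv.prod_comp σ fun i => C ((p i).rep 0) + C ((p i).rep 1) * X
  have hcoords : formCoords (fun i => ((p ∘ σ) i).rep) = formCoords fun i => (p i).rep :=
    funext fun k => congrArg (fun f => coeff f k) hform
  rw [symPoint_eq_toProj, symPoint_eq_toProj, hcoords]

theorem antipode_symPoint (p : Fin d → ℙ ℂ (Fin 2 → ℂ)) :
    antipode (symPoint p) = symPoint (antipode ∘ p) := by
  have hp : p = fun i => toProj (p i).rep := funext fun i => (toProj_rep _).symm
  have hp0 : ∀ i, (p i).rep ≠ 0 := fun i => (p i).rep_nonzero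
  have hap : antipode ∘ p = fun i => toProj (quat (p i).rep) :=
    funext fun i => by rw [← antipode_toProj (hp0 i), toProj_rep, Function.comp_apply]
  rw [hap, symPoint_toProj fun i => quat_ne_zero (hp0 i), formCoords_quat,
    ← antipode_toProj (formCoords_ne_zero _ hp0), ← symPoint_toProj hp0, ← hp]

end BinaryForms

/-! ## Orbits of configurations -/

section Orbits

open scoped ComplexConjugate Matrix

variable {d : ℕ} (C : Fin d → ℙ ℂ (Fin 2 → ℂ)) (A : Matrix.SpecialLinearGroup (Fin 2) ℂ)

theorem mulVec_ne_zero {v : Fin 2 → ℂ} (hv : v ≠ 0) : A.1 *ᵥ v ≠ 0 := fun h =>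
  hv (Matrix.eq_zero_of_mulVec_eq_zero (A.det_coe.trans_ne one_ne_zero) h)

theorem smul_toProj {v : Fin 2 → ℂ} (hv : v ≠ 0) : A • toProj v = toProj (A.1 *ᵥ v) := by
  rw [toProj_of_ne_zero hv, toProj_of_ne_zero (mulVec_ne_zero A hv)]
  rfl

theorem orbitPoint_toProj {v : Fin d → Fin 2 → ℂ} (hv : ∀ i, v i ≠ 0) :
    orbitPoint (fun i => toProj (v i)) A = toProj (formCoords fun i => A.1 *ᵥ v i) := by
  simp only [orbitPoint, smul_toProj A (hv _)]
  exact symPoint_toProj fun i => mulVec_ne_zero A (hv i)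

theorem ddag_mulVec_quat (v : Fin 2 → ℂ) : (ddag A).1 *ᵥ quat v = quat (A.1 *ᵥ v) := by
  have hddag : (ddag A).1 = (A.1.adjugate)ᴴ := rfl
  rw [hddag, Matrix.adjugate_fin_two]
  funext i
  fin_cases i
  · simp [quat_apply, Matrix.mulVec, dotProduct, Fin.sum_univ_two]
  · simp [quat_apply, Matrix.mulVec, dotProduct, Fin.sum_univ_two, add_comm]

theorem ddag_smul_antipode (p : ℙ ℂ (Fin 2 → ℂ)) : ddag A • antipode p = antipode (A • p) := by
  rw [← toProj_rep p, antipode_toProj p.rep_nonzero, smul_toProj A p.rep_nonzero,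
    antipode_toProj (mulVec_ne_zero A p.rep_nonzero), smul_toProj _ (quat_ne_zero p.rep_nonzero),
    ddag_mulVec_quat]

theorem antipode_orbitPoint :
    antipode (orbitPoint C A) = orbitPoint (antipode ∘ C) (ddag A) := by
  rw [orbitPoint, antipode_symPoint, orbitPoint]
  simp only [Function.comp_def, ddag_smul_antipode]

variable {C A}

theorem ddag_eq_self (hA : A.1 ∈ Matrix.specialUnitaryGroup (Fin 2) ℂ) : ddag A = A := by
  have hstar : (A⁻¹ : Matrix.SpecialLinearGroup (Fin 2) ℂ).1 = star A.1 := by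
    have hinv : A.1 * (A⁻¹ : Matrix.SpecialLinearGroup (Fin 2) ℂ).1 = 1 := by
      rw [← Matrix.SpecialLinearGroup.coe_mul, mul_inv_cancel, Matrix.SpecialLinearGroup.coe_one]
    exact (left_inv_eq_right_inv (Matrix.mem_unitaryGroup_iff'.1 hA.1) hinv).symm
  have hddag : (ddag A).1 = ((A⁻¹ : Matrix.SpecialLinearGroup (Fin 2) ℂ).1)ᴴ := rfl
  refine Subtype.ext ?_
  rw [hddag, hstar, Matrix.star_eq_conjTranspose, Matrix.conjTranspose_conjTranspose]

theorem lagrangian_subset_openOrbit : lagrangian C ⊆ openOrbit C := by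
  rintro p ⟨A, -, rfl⟩
  exact ⟨A, rfl⟩

end Orbits

/-! ## Antipodal covariants -/

open scoped ComplexConjugate

/-- A homogeneous lift `Ψ` of an `SL(2, ℂ)`-equivariant rational map that carries `A · C`
to `A · C'`, where `C'` consists of the antipodes of the points of `C`. -/
structure IsAntipodalCovariant {d : ℕ} (C : Fin d → ℙ ℂ (Fin 2 → ℂ))
    (Ψ : (Fin (d + 1) → ℂ) → Fin (d + 1) → ℂ) (m : ℕ) : Prop extends IsHomogeneousMap Ψ m where
  rep_orbitPoint_ne_zero : ∀ A, Ψ (orbitPoint C A).rep ≠ 0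
  ratMap_orbitPoint : ∀ A, ratMap Ψ (orbitPoint C A) = orbitPoint (antipode ∘ C) A

namespace IsAntipodalCovariant

variable {d m : ℕ} {C : Fin d → ℙ ℂ (Fin 2 → ℂ)} {Ψ : (Fin (d + 1) → ℂ) → Fin (d + 1) → ℂ}
  {p : ℙ ℂ (Fin (d + 1) → ℂ)} {u v : ℂ → ℙ ℂ (Fin (d + 1) → ℂ)} {U : Set ℂ}

theorem antipode_ratMap_orbitPoint (h : IsAntipodalCovariant C Ψ m)
    (A : Matrix.SpecialLinearGroup (Fin 2) ℂ) :
    antipode (ratMap Ψ (orbitPoint C A)) = orbitPoint C (ddag A) := by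
  have hC : antipode ∘ antipode ∘ C = C := funext fun i => antipode_antipode (C i)
  rw [h.ratMap_orbitPoint, antipode_orbitPoint, hC]

theorem rep_ne_zero (h : IsAntipodalCovariant C Ψ m) (hp : p ∈ openOrbit C) : Ψ p.rep ≠ 0 := by
  obtain ⟨A, rfl⟩ := hp
  exact h.rep_orbitPoint_ne_zero A

theorem antipode_ratMap_eq_tau (h : IsAntipodalCovariant C Ψ m) (hp : p ∈ openOrbit C) :
    antipode (ratMap Ψ p) = tau C p := by
  have hA : ∃ A, orbitPoint C A = p := hp
  rw [tau, dif_pos hA, ← h.antipode_ratMap_orbitPoint, hA.choose_spec]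

theorem tau_orbitPoint (h : IsAntipodalCovariant C Ψ m)
    (A : Matrix.SpecialLinearGroup (Fin 2) ℂ) :
    tau C (orbitPoint C A) = orbitPoint C (ddag A) := by
  rw [← h.antipode_ratMap_eq_tau ⟨A, rfl⟩, h.antipode_ratMap_orbitPoint]

theorem antipode_ratMap_eq_self (h : IsAntipodalCovariant C Ψ m) (hp : p ∈ lagrangian C) :
    antipode (ratMap Ψ p) = p := by
  obtain ⟨A, hA, rfl⟩ := hp
  rw [h.antipode_ratMap_orbitPoint, ddag_eq_self hA]

theorem antipode_ratMap_mem_orbitClosure (h : IsAntipodalCovariant C Ψ m)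
    (hp : p ∈ orbitClosure C) (hp0 : Ψ p.rep ≠ 0) : antipode (ratMap Ψ p) ∈ orbitClosure C := by
  have hcont : ContinuousAt (fun q => antipode (ratMap Ψ q)) p :=
    continuous_antipode.continuousAt.comp (h.continuousAt_ratMap hp0)
  have hmem := mem_closure_image hcont hp
  refine closure_mono ?_ hmem
  rintro _ ⟨_, ⟨A, rfl⟩, rfl⟩
  exact ⟨ddag A, (h.antipode_ratMap_orbitPoint A).symm⟩

theorem mapsTo_antipode_comp (h : IsAntipodalCovariant C Ψ m) (hU : IsOpen U)
    (hu : Set.MapsTo u U (orbitClosure C)) (hne : ∀ z ∈ U, ∃ᶠ y in 𝓝 z, Ψ (u y).rep ≠ 0)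
    (hv : HolomorphicOnOpen v U) (hvu : ∀ z, Ψ (u z).rep ≠ 0 → v z = ratMap Ψ (u z)) :
    Set.MapsTo (antipode ∘ v) U (orbitClosure C) := by
  intro z hz
  have hfreq : ∃ᶠ y in 𝓝 z, antipode (v y) ∈ orbitClosure C := by
    refine ((hne z hz).and_eventually (hU.mem_nhds hz)).mono fun y hy => ?_
    rw [hvu y hy.1]
    exact h.antipode_ratMap_mem_orbitClosure (hu hy.2) hy.1
  exact isClosed_closure.mem_of_frequently_of_tendsto hfreq
    (continuous_antipode.continuousAt.comp (hv z hz).continuousAt)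

theorem exists_continuousOn_extension (h : IsAntipodalCovariant C Ψ m) (hU : IsOpen U)
    (hu : HolomorphicOnOpen u U) (huX : Set.MapsTo u U (orbitClosure C)) {a : ℂ}
    (huW : Set.MapsTo u (U \ {a}) (openOrbit C)) :
    ∃ v : ℂ → ℙ ℂ (Fin (d + 1) → ℂ), ContinuousOn v U ∧ Set.MapsTo v U (orbitClosure C) ∧
      Set.EqOn v (tau C ∘ u) (U \ {a}) := by
  have hne : ∀ z ∈ U, ∃ᶠ y in 𝓝 z, Ψ (u y).rep ≠ 0 := fun z hz =>
    ((mem_closure_iff_frequently.1 (dense_compl_singleton a z)).and_eventually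
      (hU.mem_nhds hz)).mono fun y hy => h.rep_ne_zero (huW ⟨hy.2, hy.1⟩)
  obtain ⟨v, hv, hvu⟩ := h.exists_holomorphicOnOpen_eq_ratMap hu hne
  refine ⟨antipode ∘ v, fun z hz => ?_, h.mapsTo_antipode_comp hU huX hne hv hvu, fun z hz => ?_⟩
  · exact (continuous_antipode.continuousAt.comp (hv z hz).continuousAt).continuousWithinAt
  · rw [Function.comp_apply, hvu z (h.rep_ne_zero (huW hz)), h.antipode_ratMap_eq_tau (huW hz)]
    rfl

end IsAntipodalCovariant

section Discs

variable {d m : ℕ} {C : Fin d → ℙ ℂ (Fin 2 → ℂ)} {Ψ : (Fin (d + 1) → ℂ) → Fin (d + 1) → ℂ}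
  {u : ℂ → ℙ ℂ (Fin (d + 1) → ℂ)}

theorem IsAntipodalCovariant.eventually_rep_ne_zero_of_disc (h : IsAntipodalCovariant C Ψ m)
    (hu : IsHolomorphicDisc C u) {z : ℂ} (hz : z ∈ Metric.sphere (0 : ℂ) 1) :
    ∀ᶠ y in 𝓝[Metric.closedBall 0 1] z, Ψ (u y).rep ≠ 0 :=
  (hu.continuousOn z (Metric.sphere_subset_closedBall hz)).eventually
    (h.eventually_rep_ne_zero (h.rep_ne_zero (lagrangian_subset_openOrbit (hu.boundary hz))))

theorem IsAntipodalCovariant.frequently_rep_ne_zero_of_disc (h : IsAntipodalCovariant C Ψ m)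
    (hu : IsHolomorphicDisc C u) :
    ∀ z ∈ Metric.ball (0 : ℂ) 1, ∃ᶠ y in 𝓝 z, Ψ (u y).rep ≠ 0 := by
  have hone : (1 : ℂ) ∈ closure (Metric.ball (0 : ℂ) 1) := by
    rw [closure_ball _ one_ne_zero]
    simp
  have := mem_closure_iff_nhdsWithin_neBot.1 hone
  have hev := (h.eventually_rep_ne_zero_of_disc hu (z := 1) (by simp)).filter_mono
    (nhdsWithin_mono 1 Metric.ball_subset_closedBall)
  obtain ⟨z₀, hne, hz₀⟩ := (hev.and self_mem_nhdsWithin).exists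
  exact h.frequently_ne_zero (convex_ball 0 1).isPreconnected hu.holomorphic hz₀ hne

theorem IsAntipodalCovariant.continuousOn_closedBall (h : IsAntipodalCovariant C Ψ m)
    (hu : IsHolomorphicDisc C u) {v : ℂ → ℙ ℂ (Fin (d + 1) → ℂ)}
    (hv : HolomorphicOnOpen v (Metric.ball 0 1))
    (hvu : ∀ z, Ψ (u z).rep ≠ 0 → v z = ratMap Ψ (u z)) :
    ContinuousOn v (Metric.closedBall 0 1) := by
  rw [← Metric.ball_union_sphere]
  rintro z (hz | hz)
  · exact (hv z hz).continuousAt.continuousWithinAt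
  · have hzD := Metric.sphere_subset_closedBall hz
    have hev := h.eventually_rep_ne_zero_of_disc hu hz
    have hz0 := hev.self_of_nhdsWithin hzD
    rw [Metric.ball_union_sphere]
    exact ((h.continuousAt_ratMap hz0).comp_continuousWithinAt
      (hu.continuousOn z hzD)).congr_of_eventuallyEq (hev.mono hvu) (hvu z hz0)

theorem conj_mem_ball {z : ℂ} {r : ℝ} : conj z ∈ Metric.ball 0 r ↔ z ∈ Metric.ball 0 r := by
  rw [mem_ball_zero_iff, mem_ball_zero_iff, RCLike.norm_conj]

theorem conj_mem_closedBall {z : ℂ} {r : ℝ} :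
    conj z ∈ Metric.closedBall 0 r ↔ z ∈ Metric.closedBall 0 r := by
  rw [mem_closedBall_zero_iff, mem_closedBall_zero_iff, RCLike.norm_conj]

theorem exists_coe_or_reflect (x : OnePoint ℂ) :
    ∃ z ∈ Metric.closedBall (0 : ℂ) 1, x = z ∨ x = reflect z := by
  induction x using OnePoint.rec with
  | infty => exact ⟨0, by simp, Or.inr (if_pos rfl).symm⟩
  | coe z =>
    rcases le_total ‖z‖ 1 with hz | hz
    · exact ⟨z, mem_closedBall_zero_iff.2 hz, Or.inl rfl⟩
    · have hz0 : z ≠ 0 := norm_pos_iff.1 (one_pos.trans_le hz)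
      refine ⟨(conj z)⁻¹, ?_, Or.inr ?_⟩
      · rw [mem_closedBall_zero_iff, norm_inv, RCLike.norm_conj]
        exact inv_le_one_of_one_le₀ hz
      · simp [reflect, hz0]

theorem exists_holomorphicSphere_reflect {n : ℕ} [NeZero n] {f g : ℂ → ℙ ℂ (Fin n → ℂ)}
    (hf : ContinuousOn f (Metric.closedBall 0 1)) (hf' : HolomorphicOnOpen f (Metric.ball 0 1))
    (hg : ContinuousOn g (Metric.closedBall 0 1)) (hg' : HolomorphicOnOpen g (Metric.ball 0 1))
    (hfg : ∀ z ∈ Metric.sphere 0 1, antipode (g z) = f z) :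
    ∃ w : OnePoint ℂ → ℙ ℂ (Fin n → ℂ), HolomorphicSphere w ∧
      (∀ z ∈ Metric.closedBall (0 : ℂ) 1, w z = f z) ∧
      ∀ z ∈ Metric.closedBall (0 : ℂ) 1, w (reflect z) = antipode (g z) := by
  have hcont : ContinuousOn (fun z => antipode (g (conj z))) (Metric.closedBall 0 1) :=
    continuous_antipode.comp_continuousOn
      (hg.comp Complex.continuous_conj.continuousOn fun z hz => conj_mem_closedBall.2 hz)
  have hboundary : ∀ z : ℂ, ‖z‖ = 1 → f z = antipode (g (conj z⁻¹)) := fun z hz => by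
    have hz' : (conj z)⁻¹ = z := by
      rw [← Complex.inv_eq_conj hz, inv_inv]
    rw [map_inv₀, hz', hfg z (mem_sphere_zero_iff_norm.2 hz)]
  obtain ⟨w, hw, hwf, hwg⟩ := exists_holomorphicSphere hf hf' hcont
    (fun z hz => (hg' _ (conj_mem_ball.2 hz)).antipode_comp_conj) hboundary
  refine ⟨w, hw, hwf, fun z hz => ?_⟩
  have hreflect := hwg (conj z) (conj_mem_closedBall.2 hz)
  simpa only [reflect, map_eq_zero, Complex.conj_conj] using hreflect

theorem IsAntipodalCovariant.exists_holomorphicSphere (h : IsAntipodalCovariant C Ψ m)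
    (hu : IsHolomorphicDisc C u) :
    ∃ w : OnePoint ℂ → ℙ ℂ (Fin (d + 1) → ℂ), HolomorphicSphere w ∧
      (∀ x, w x ∈ orbitClosure C) ∧ (∀ z ∈ Metric.closedBall (0 : ℂ) 1, w z = u z) ∧
      ∀ z ∈ Metric.closedBall (0 : ℂ) 1, u z ∈ openOrbit C → w (reflect z) = tau C (u z) := by
  have hne := h.frequently_rep_ne_zero_of_disc hu
  obtain ⟨v, hv, hvu⟩ := h.exists_holomorphicOnOpen_eq_ratMap hu.holomorphic hne
  have hvW : ∀ z, u z ∈ openOrbit C → v z = ratMap Ψ (u z) := fun z hz => hvu z (h.rep_ne_zero hz)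
  have hboundary : ∀ z ∈ Metric.sphere 0 1, antipode (v z) = u z := fun z hz => by
    rw [hvW z (lagrangian_subset_openOrbit (hu.boundary hz)),
      h.antipode_ratMap_eq_self (hu.boundary hz)]
  have hball : Set.MapsTo (antipode ∘ v) (Metric.ball 0 1) (orbitClosure C) :=
    h.mapsTo_antipode_comp Metric.isOpen_ball
      (hu.mapsTo.mono_left Metric.ball_subset_closedBall) hne hv hvu
  have hclosed : ∀ z ∈ Metric.closedBall 0 1, antipode (v z) ∈ orbitClosure C := fun z hz => by
    rcases (Metric.ball_union_sphere (x := (0 : ℂ)) (ε := 1)).symm ▸ hz with hz' | hz'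
    · exact hball hz'
    · exact hboundary z hz' ▸ hu.mapsTo hz
  obtain ⟨w, hw, hwu, hwv⟩ := exists_holomorphicSphere_reflect hu.continuousOn hu.holomorphic
    (h.continuousOn_closedBall hu hv hvu) hv hboundary
  refine ⟨w, hw, fun x => ?_, hwu, fun z hz hzW => ?_⟩
  · obtain ⟨z, hz, rfl | rfl⟩ := exists_coe_or_reflect x
    · exact hwu z hz ▸ hu.mapsTo hz
    · exact hwv z hz ▸ hclosed z hz
  · rw [hwv z hz, hvW z hzW, h.antipode_ratMap_eq_tau hzW]

end Discs

/-! ## Covariants of binary cubics and quartics -/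

section CoeffMap

open Polynomial

/-- The map on coefficient vectors induced by an operation `T` on polynomials. -/
def coeffMap {R : Type*} [Semiring R] [DecidableEq R] (n : ℕ) (T : R[X] → R[X])
    (z : Fin n → R) : Fin n → R :=
  toFn n (T (ofFn n z))

/-- Differentiability of a family of polynomials, coefficient by coefficient. -/
def DifferentiableCoeffs {E : Type*} [NormedAddCommGroup E] [NormedSpace ℂ E] (F : E → ℂ[X]) :
    Prop :=
  ∀ k, Differentiable ℂ fun z => (F z).coeff k

namespace DifferentiableCoeffs

variable {E : Type*} [NormedAddCommGroup E] [NormedSpace ℂ E] {F G : E → ℂ[X]}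

theorem const (f : ℂ[X]) : DifferentiableCoeffs fun _ : E => f := fun _ =>
  differentiable_const _

theorem add (hF : DifferentiableCoeffs F) (hG : DifferentiableCoeffs G) :
    DifferentiableCoeffs fun z => F z + G z := fun k => by
  simpa only [coeff_add] using (hF k).fun_add (hG k)

theorem sub (hF : DifferentiableCoeffs F) (hG : DifferentiableCoeffs G) :
    DifferentiableCoeffs fun z => F z - G z := fun k => by
  simpa only [coeff_sub] using (hF k).fun_sub (hG k)

theorem mul (hF : DifferentiableCoeffs F) (hG : DifferentiableCoeffs G) :
    DifferentiableCoeffs fun z => F z * G z := fun k => by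
  simp only [coeff_mul]
  exact Differentiable.fun_sum fun x _ => (hF x.1).mul (hG x.2)

theorem derivative (hF : DifferentiableCoeffs F) :
    DifferentiableCoeffs fun z => (F z).derivative := fun k => by
  simp only [coeff_derivative]
  exact (hF (k + 1)).mul_const _

end DifferentiableCoeffs

theorem differentiableCoeffs_ofFn (n : ℕ) :
    DifferentiableCoeffs fun z : Fin n → ℂ => ofFn n z := fun k => by
  by_cases hk : k < n
  · simpa only [ofFn_coeff_eq_val_of_lt _ hk] using differentiable_apply _
  · simpa only [ofFn_coeff_eq_zero_of_ge _ (not_lt.1 hk)] using differentiable_const _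

theorem isHomogeneousMap_coeffMap {n m : ℕ} {T : ℂ[X] → ℂ[X]}
    (hT : DifferentiableCoeffs fun z : Fin n → ℂ => T (ofFn n z))
    (hsmul : ∀ (c : ℂ) f, T (c • f) = c ^ m • T f) : IsHomogeneousMap (coeffMap n T) m where
  differentiable := differentiable_pi.2 fun k => hT k
  map_smul c v := by rw [coeffMap, map_smul, hsmul, map_smul, coeffMap]

/-- The cubic covariant of the binary cubic with dehomogenisation `f`, up to a scalar. -/
def cubicCovariant {R : Type*} [CommRing R] (f : R[X]) : R[X] :=
  9 * (f * f * derivative (derivative (derivative f))) -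
    9 * (f * derivative f * derivative (derivative f)) +
    4 * (derivative f * derivative f * derivative f)

/-- The Hessian of the binary quartic with dehomogenisation `f`, up to a scalar. -/
def quarticHessian {R : Type*} [CommRing R] (f : R[X]) : R[X] :=
  4 * (f * derivative (derivative f)) - 3 * (derivative f * derivative f)

theorem isHomogeneousMap_cubicCovariant (n : ℕ) :
    IsHomogeneousMap (coeffMap n (cubicCovariant (R := ℂ))) 3 := by
  have h₀ := differentiableCoeffs_ofFn n
  have h₁ := h₀.derivative
  have h₂ := h₁.derivative
  refine isHomogeneousMap_coeffMap
    (((DifferentiableCoeffs.const 9).mul ((h₀.mul h₀).mul h₂.derivative)).sub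
      ((DifferentiableCoeffs.const 9).mul ((h₀.mul h₁).mul h₂)) |>.add
      ((DifferentiableCoeffs.const 4).mul ((h₁.mul h₁).mul h₁))) fun c f => ?_
  simp only [cubicCovariant, smul_eq_C_mul, derivative_C_mul, map_pow]
  ring

theorem isHomogeneousMap_quarticHessian (n : ℕ) :
    IsHomogeneousMap (coeffMap n (quarticHessian (R := ℂ))) 2 := by
  have h₀ := differentiableCoeffs_ofFn n
  have h₁ := h₀.derivative
  refine isHomogeneousMap_coeffMap
    (((DifferentiableCoeffs.const 4).mul (h₀.mul h₁.derivative)).sub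
      ((DifferentiableCoeffs.const 3).mul (h₁.mul h₁))) fun c f => ?_
  simp only [quarticHessian, smul_eq_C_mul, derivative_C_mul, map_pow]
  ring

variable {R : Type*} [CommRing R] {p q : R[X]} {α β : R}

theorem cubicCovariant_normalForm (hp : derivative p = C α) (hq : derivative q = C β) (e : R) :
    cubicCovariant (p * (p ^ 2 + C e * q ^ 2)) =
      4 * C e ^ 2 * (C α * q - p * C β) ^ 3 * (q * (C e * q ^ 2 + 9 * p ^ 2)) := by
  simp only [cubicCovariant, pow_two, derivative_mul, derivative_add, derivative_C,
    derivative_zero, hp, hq]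
  ring

theorem quarticHessian_normalForm (hp : derivative p = C α) (hq : derivative q = C β) (e : R) :
    quarticHessian (p * (p ^ 3 + C e * q ^ 3)) =
      -3 * C e * (C α * q - p * C β) ^ 2 * (q * (C e * q ^ 3 - 8 * p ^ 3)) := by
  simp only [quarticHessian, pow_succ, pow_zero, one_mul, derivative_mul, derivative_add,
    derivative_C, derivative_zero, hp, hq]
  ring

end CoeffMap

section Pencil

open Polynomial
open scoped ComplexConjugate Matrix

/-- The determinant of two vectors of `ℂ²`. -/
def bracket (l m : Fin 2 → ℂ) : ℂ :=
  l 0 * m 1 - l 1 * m 0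

/-- The dehomogenised linear form with coefficient vector `l`. -/
def linearForm (l : Fin 2 → ℂ) : ℂ[X] :=
  C (l 0) + C (l 1) * X

/-- The linear form `l` followed by the members `l + a j • m` of the pencil that it spans
with `m`. -/
def pencil {n : ℕ} (l m : Fin 2 → ℂ) (a : Fin n → ℂ) : Fin (n + 1) → Fin 2 → ℂ :=
  Fin.cons l fun j => l + a j • m

variable {n : ℕ} {l m : Fin 2 → ℂ}

theorem bracket_swap (l m : Fin 2 → ℂ) : bracket m l = -bracket l m := by
  simp only [bracket]
  ring

theorem ne_zero_of_bracket_ne_zero (h : bracket l m ≠ 0) : l ≠ 0 := fun hl =>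
  h (by simp [bracket, hl])

theorem bracket_mulVec (A : Matrix.SpecialLinearGroup (Fin 2) ℂ) (l m : Fin 2 → ℂ) :
    bracket (A.1 *ᵥ l) (A.1 *ᵥ m) = bracket l m := by
  have hdet : A.1 0 0 * A.1 1 1 - A.1 0 1 * A.1 1 0 = 1 := by
    rw [← Matrix.det_fin_two, A.det_coe]
  simp only [bracket, Matrix.mulVec, dotProduct, Fin.sum_univ_two]
  linear_combination (l 0 * m 1 - l 1 * m 0) * hdet

theorem bracket_quat_ne_zero (hl : l ≠ 0) : bracket l (quat l) ≠ 0 := by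
  have hbracket : bracket l (quat l) = ((Complex.normSq (l 0) + Complex.normSq (l 1) : ℝ) : ℂ) := by
    simp [bracket, quat_apply, Complex.mul_conj]
  rw [hbracket, Ne, Complex.ofReal_eq_zero,
    add_eq_zero_iff_of_nonneg (Complex.normSq_nonneg _) (Complex.normSq_nonneg _),
    Complex.normSq_eq_zero, Complex.normSq_eq_zero]
  rintro ⟨h0, h1⟩
  exact hl (funext (Fin.forall_fin_two.2 ⟨h0, h1⟩))

theorem derivative_linearForm (l : Fin 2 → ℂ) : derivative (linearForm l) = C (l 1) := by
  simp [linearForm]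

theorem C_mul_linearForm_sub (l m : Fin 2 → ℂ) :
    C (l 1) * linearForm m - linearForm l * C (m 1) = C (-bracket l m) := by
  simp only [linearForm, bracket, map_neg, map_sub, map_mul]
  ring

theorem linearForm_add_smul (l m : Fin 2 → ℂ) (c : ℂ) :
    linearForm (l + c • m) = linearForm l + C c * linearForm m := by
  simp only [linearForm, Pi.add_apply, Pi.smul_apply, smul_eq_mul, map_add, map_mul]
  ring

theorem formPoly_pencil (l m : Fin 2 → ℂ) (a : Fin n → ℂ) :
    formPoly (pencil l m a) = linearForm l * ∏ j, (linearForm l + C (a j) * linearForm m) := by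
  simp only [← linearForm_add_smul]
  exact Fin.prod_univ_succ _

theorem mulVec_pencil (A : Matrix (Fin 2) (Fin 2) ℂ) (l m : Fin 2 → ℂ) (a : Fin n → ℂ)
    (i : Fin (n + 1)) : A *ᵥ pencil l m a i = pencil (A *ᵥ l) (A *ᵥ m) a i := by
  cases i using Fin.cases with
  | zero => rfl
  | succ j => simp only [pencil, Fin.cons_succ, Matrix.mulVec_add, Matrix.mulVec_smul]

theorem quat_pencil (l : Fin 2 → ℂ) (a : Fin n → ℂ) (i : Fin (n + 1)) :
    quat (pencil l (quat l) a i) = pencil (quat l) l (fun j => -conj (a j)) i := by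
  cases i using Fin.cases with
  | zero => rfl
  | succ j => simp [pencil, map_smulₛₗ, quat_quat]

theorem pencil_ne_zero (h : bracket l m ≠ 0) (a : Fin n → ℂ) (i : Fin (n + 1)) :
    pencil l m a i ≠ 0 := by
  refine ne_zero_of_bracket_ne_zero (m := m) ?_
  have hbracket : bracket (pencil l m a i) m = bracket l m := by
    cases i using Fin.cases with
    | zero => rfl
    | succ j => simp [pencil, bracket]; ring
  rwa [hbracket]

theorem formCoords_pencil_ne_zero (h : bracket l m ≠ 0) (a : Fin n → ℂ) :
    formCoords (pencil l m a) ≠ 0 :=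
  formCoords_ne_zero _ (pencil_ne_zero h a)

theorem orbitPoint_pencil (h : bracket l m ≠ 0) (a : Fin n → ℂ)
    (A : Matrix.SpecialLinearGroup (Fin 2) ℂ) :
    orbitPoint (fun i => toProj (pencil l m a i)) A =
      toProj (formCoords (pencil (A.1 *ᵥ l) (A.1 *ᵥ m) a)) := by
  simp only [orbitPoint_toProj A (pencil_ne_zero h a), mulVec_pencil]

theorem antipode_pencil (h : bracket l (quat l) ≠ 0) (a : Fin n → ℂ) :
    (antipode ∘ fun i => toProj (pencil l (quat l) a i)) =
      fun i => toProj (pencil (quat l) l (fun j => -conj (a j)) i) := by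
  simp only [Function.comp_def, antipode_toProj (pencil_ne_zero h a _), quat_pencil]

end Pencil

section NormalForms

open Polynomial
open scoped ComplexConjugate Matrix

theorem coeffMap_formCoords {d : ℕ} (T : ℂ[X] → ℂ[X]) (v : Fin d → Fin 2 → ℂ) :
    coeffMap (d + 1) T (formCoords v) = toFn (d + 1) (T (formPoly v)) := by
  have hdeg : (formPoly v).natDegree ≤ d := by
    refine (natDegree_prod_le_card Finset.univ fun i => ?_).trans_eq (Finset.card_fin d)
    rw [add_comm]
    exact natDegree_linear_le
  have hform : ofFn (d + 1) (formCoords v) = formPoly v :=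
    ofFn_comp_toFn_eq_id_of_natDegree_lt (Nat.lt_succ_of_le hdeg)
  rw [coeffMap, hform]

theorem isAntipodalCovariant_pencil {n m : ℕ} {l : Fin 2 → ℂ} (hl : l ≠ 0) {a : Fin n → ℂ}
    {T : ℂ[X] → ℂ[X]} (hT : IsHomogeneousMap (coeffMap (n + 2) T) m)
    (hform : ∀ p q : Fin 2 → ℂ, bracket p q ≠ 0 → ∃ c : ℂ, c ≠ 0 ∧
      T (formPoly (pencil p q a)) = c • formPoly (pencil q p fun j => -conj (a j))) :
    IsAntipodalCovariant (fun i => toProj (pencil l (quat l) a i)) (coeffMap (n + 2) T) m := by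
  have hlq := bracket_quat_ne_zero hl
  have hql : bracket (quat l) l ≠ 0 := by rwa [bracket_swap, neg_ne_zero]
  have hmap : ∀ A : Matrix.SpecialLinearGroup (Fin 2) ℂ, ∃ c : ℂ, c ≠ 0 ∧
      coeffMap (n + 2) T (formCoords (pencil (A.1 *ᵥ l) (A.1 *ᵥ quat l) a)) =
        c • formCoords (pencil (A.1 *ᵥ quat l) (A.1 *ᵥ l) fun j => -conj (a j)) := fun A => by
    obtain ⟨c, hc, h⟩ := hform (A.1 *ᵥ l) (A.1 *ᵥ quat l) (by rwa [bracket_mulVec])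
    exact ⟨c, hc, by rw [coeffMap_formCoords, h, map_smul]; rfl⟩
  have hne : ∀ A : Matrix.SpecialLinearGroup (Fin 2) ℂ,
      formCoords (pencil (A.1 *ᵥ l) (A.1 *ᵥ quat l) a) ≠ 0 := fun A =>
    formCoords_pencil_ne_zero (by rwa [bracket_mulVec]) a
  refine { hT with rep_orbitPoint_ne_zero := fun A => ?_, ratMap_orbitPoint := fun A => ?_ } <;>
    obtain ⟨c, hc, h⟩ := hmap A
  · rw [orbitPoint_pencil hlq, Ne, hT.rep_toProj_eq_zero (hne A), h]
    exact smul_ne_zero hc (formCoords_pencil_ne_zero (by rwa [bracket_mulVec]) _)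
  · rw [antipode_pencil hlq, orbitPoint_pencil hlq, orbitPoint_pencil hql,
      hT.ratMap_toProj (hne A), h, toProj_smul hc]

theorem formPoly_pencil_two (p q : Fin 2 → ℂ) {a : Fin 2 → ℂ} (hsum : ∑ j, a j = 0) :
    formPoly (pencil p q a) =
      linearForm p * (linearForm p ^ 2 + C (∏ j, a j) * linearForm q ^ 2) := by
  have hsum' : C (a 0) + C (a 1) = 0 := by rw [← C_add, ← Fin.sum_univ_two, hsum, C_0]
  rw [formPoly_pencil, Fin.prod_univ_two, Fin.prod_univ_two, C_mul]
  linear_combination (linearForm p ^ 2 * linearForm q) * hsum'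

theorem formPoly_pencil_three (p q : Fin 2 → ℂ) {a : Fin 3 → ℂ} (hsum : ∑ j, a j = 0)
    (hsum₂ : a 0 * a 1 + a 0 * a 2 + a 1 * a 2 = 0) :
    formPoly (pencil p q a) =
      linearForm p * (linearForm p ^ 3 + C (∏ j, a j) * linearForm q ^ 3) := by
  have hC : C (a 0) + C (a 1) + C (a 2) = 0 := by
    rw [← C_add, ← C_add, ← Fin.sum_univ_three, hsum, C_0]
  have hC₂ : C (a 0) * C (a 1) + C (a 0) * C (a 2) + C (a 1) * C (a 2) = 0 := by
    rw [← C_mul, ← C_mul, ← C_mul, ← C_add, ← C_add, hsum₂, C_0]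
  rw [formPoly_pencil, Fin.prod_univ_three, Fin.prod_univ_three, C_mul, C_mul]
  linear_combination (linearForm p ^ 3 * linearForm q) * hC +
    (linearForm p ^ 2 * linearForm q ^ 2) * hC₂

theorem isAntipodalCovariant_cubicCovariant {l : Fin 2 → ℂ} (hl : l ≠ 0) {a : Fin 2 → ℂ}
    (hsum : ∑ j, a j = 0) (hnorm : ∀ j, a j * conj (a j) = 3) :
    IsAntipodalCovariant (fun i => toProj (pencil l (quat l) a i))
      (coeffMap 4 cubicCovariant) 3 := by
  refine isAntipodalCovariant_pencil hl (isHomogeneousMap_cubicCovariant 4) fun p q hpq => ?_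
  set e := ∏ j, a j with he
  have hsum' : ∑ j, -conj (a j) = 0 := by
    rw [Finset.sum_neg_distrib, ← map_sum, hsum, map_zero, neg_zero]
  have hee : e * ∏ j, -conj (a j) = 9 := by
    rw [he, ← Finset.prod_mul_distrib, Fin.prod_univ_two]
    linear_combination a 1 * conj (a 1) * hnorm 0 + 3 * hnorm 1
  have he0 : e ≠ 0 := left_ne_zero_of_mul (hee.trans_ne (by norm_num))
  have heeC : C e * C (∏ j, -conj (a j)) = 9 := by rw [← C_mul, hee]; rfl
  refine ⟨4 * e ^ 3 * (-bracket p q) ^ 3, ?_, ?_⟩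
  · exact mul_ne_zero (mul_ne_zero (by norm_num) (pow_ne_zero _ he0))
      (pow_ne_zero _ (neg_ne_zero.2 hpq))
  · rw [formPoly_pencil_two p q hsum, formPoly_pencil_two q p hsum', ← he,
      cubicCovariant_normalForm (derivative_linearForm p) (derivative_linearForm q),
      C_mul_linearForm_sub, smul_eq_C_mul, C_mul, C_mul, C_pow, C_pow]
    simp only [map_ofNat]
    linear_combination -4 * C e ^ 2 * C (-bracket p q) ^ 3 * linearForm q * linearForm p ^ 2 * heeC

theorem sum_mul_eq_zero_of_mul_conj_eq {a : Fin 3 → ℂ} {r : ℂ} (hr : r ≠ 0) (hsum : ∑ j, a j = 0)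
    (hnorm : ∀ j, a j * conj (a j) = r) : a 0 * a 1 + a 0 * a 2 + a 1 * a 2 = 0 := by
  have hconj : conj (a 0) + conj (a 1) + conj (a 2) = 0 := by
    rw [← map_add, ← map_add, ← Fin.sum_univ_three, hsum, map_zero]
  refine (mul_eq_zero.1 ?_).resolve_left hr
  linear_combination a 0 * a 1 * a 2 * hconj - a 0 * a 1 * hnorm 2 - a 0 * a 2 * hnorm 1 -
    a 1 * a 2 * hnorm 0

theorem isAntipodalCovariant_quarticHessian {l : Fin 2 → ℂ} (hl : l ≠ 0) {a : Fin 3 → ℂ}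
    (hsum : ∑ j, a j = 0) (hnorm : ∀ j, a j * conj (a j) = 2) :
    IsAntipodalCovariant (fun i => toProj (pencil l (quat l) a i))
      (coeffMap 5 quarticHessian) 2 := by
  refine isAntipodalCovariant_pencil hl (isHomogeneousMap_quarticHessian 5) fun p q hpq => ?_
  set e := ∏ j, a j with he
  have hsum' : ∑ j, -conj (a j) = 0 := by
    rw [Finset.sum_neg_distrib, ← map_sum, hsum, map_zero, neg_zero]
  have hnorm' : ∀ j, -conj (a j) * conj (-conj (a j)) = 2 := fun j => by
    rw [map_neg, Complex.conj_conj, neg_mul_neg, mul_comm, hnorm]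
  have hee : e * ∏ j, -conj (a j) = -8 := by
    rw [he, ← Finset.prod_mul_distrib, Finset.prod_congr rfl fun j _ => mul_neg (a j) (conj (a j))]
    simp only [hnorm, Fin.prod_univ_three]
    norm_num
  have he0 : e ≠ 0 := left_ne_zero_of_mul (hee.trans_ne (by norm_num))
  have heeC : C e * C (∏ j, -conj (a j)) = -8 := by
    rw [← C_mul, hee, C_neg]
    rfl
  refine ⟨-3 * e ^ 2 * (-bracket p q) ^ 2, ?_, ?_⟩
  · exact mul_ne_zero (mul_ne_zero (by norm_num) (pow_ne_zero _ he0))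
      (pow_ne_zero _ (neg_ne_zero.2 hpq))
  · rw [formPoly_pencil_three p q hsum (sum_mul_eq_zero_of_mul_conj_eq two_ne_zero hsum hnorm),
      formPoly_pencil_three q p hsum' (sum_mul_eq_zero_of_mul_conj_eq two_ne_zero hsum' hnorm'),
      ← he, quarticHessian_normalForm (derivative_linearForm p) (derivative_linearForm q),
      C_mul_linearForm_sub, smul_eq_C_mul, C_mul, C_mul, C_pow, C_pow]
    simp only [C_neg, map_ofNat]
    linear_combination 3 * C e * (-C (bracket p q)) ^ 2 * linearForm q * linearForm p ^ 3 * heeC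

theorem isAntipodalCovariant_id {d : ℕ} {C : Fin d → ℙ ℂ (Fin 2 → ℂ)} (σ : Equiv.Perm (Fin d))
    (hσ : antipode ∘ C = C ∘ σ) : IsAntipodalCovariant C id 1 where
  differentiable := differentiable_id
  map_smul c v := by rw [pow_one, id, id]
  rep_orbitPoint_ne_zero A := (orbitPoint C A).rep_nonzero
  ratMap_orbitPoint A := by
    rw [ratMap, id, toProj_rep, hσ, orbitPoint, orbitPoint, ← symPoint_comp_perm σ]
    rfl

end NormalForms

/-! ## The unit sphere in Hermitian matrices -/

section Stereographic

open scoped ComplexConjugate Matrix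

/-- The traceless Hermitian matrix `p · σ` of a vector `p` of `ℝ³`, where `σ` consists of the Pauli
matrices, with the sign of the second one chosen to match `stereoVec`. -/
def pauli : EuclideanSpace ℝ (Fin 3) →ₗ[ℝ] Matrix (Fin 2) (Fin 2) ℂ where
  toFun p := !![(p 2 : ℂ), p 0 + Complex.I * p 1; p 0 - Complex.I * p 1, -p 2]
  map_add' p q := by
    ext i j
    fin_cases i <;> fin_cases j <;> simp <;> ring
  map_smul' c p := by
    ext i j
    fin_cases i <;> fin_cases j <;> simp <;> ring

theorem pauli_apply (p : EuclideanSpace ℝ (Fin 3)) :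
    pauli p = !![(p 2 : ℂ), p 0 + Complex.I * p 1; p 0 - Complex.I * p 1, -p 2] := rfl

theorem sum_bracket {ι : Type*} [Fintype ι] (l : Fin 2 → ℂ) (v : ι → Fin 2 → ℂ) :
    ∑ i, bracket l (v i) = bracket l (∑ i, v i) := by
  simp only [bracket, Finset.sum_apply, Finset.sum_sub_distrib, Finset.mul_sum]

theorem bracket_neg (l v : Fin 2 → ℂ) : bracket l (-v) = -bracket l v := by
  simp only [bracket, Pi.neg_apply]
  ring

theorem smul_eq_smul_add_smul_quat (s v : Fin 2 → ℂ) :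
    (s ⬝ᵥ star s) • v = (v ⬝ᵥ star s) • s + bracket s v • quat s := by
  funext i
  fin_cases i <;> simp [dotProduct, Fin.sum_univ_two, bracket, quat_apply] <;> ring

theorem bracket_mul_conj (s v : Fin 2 → ℂ) :
    bracket s v * conj (bracket s v) =
      (s ⬝ᵥ star s) * (v ⬝ᵥ star v) - (v ⬝ᵥ star s) * conj (v ⬝ᵥ star s) := by
  simp [dotProduct, Fin.sum_univ_two, bracket]
  ring

theorem bracket_mul_conj_dotProduct (s v : Fin 2 → ℂ) :
    bracket s v * conj (v ⬝ᵥ star s) = bracket s (Matrix.vecMulVec v (star v) *ᵥ s) := by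
  simp [dotProduct, Fin.sum_univ_two, bracket, Matrix.vecMulVec_mulVec]
  ring

theorem dotProduct_mul_conj (s v : Fin 2 → ℂ) :
    (v ⬝ᵥ star s) * conj (v ⬝ᵥ star s) =
      (Matrix.vecMulVec s (star s) * Matrix.vecMulVec v (star v)).trace := by
  simp [dotProduct, Fin.sum_univ_two, Matrix.vecMulVec_mul_vecMulVec]
  ring

theorem trace_one_add_pauli_mul (p q : EuclideanSpace ℝ (Fin 3)) :
    ((1 + pauli p) * (1 + pauli q)).trace = 2 * (1 + inner ℝ p q : ℝ) := by
  have hI := Complex.I_sq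
  simp [pauli_apply, Matrix.trace_fin_two, Matrix.mul_apply, Fin.sum_univ_two, PiLp.inner_apply,
    Fin.sum_univ_three]
  linear_combination -2 * (p 1 : ℂ) * q 1 * hI

variable {p q : EuclideanSpace ℝ (Fin 3)}

theorem dotProduct_stereoVec_ne_zero (p : EuclideanSpace ℝ (Fin 3)) :
    stereoVec p ⬝ᵥ star (stereoVec p) ≠ 0 := by
  open scoped ComplexOrder in
  exact dotProduct_self_star_eq_zero.not.2 (stereoVec_ne_zero p)

theorem vecMulVec_stereoVec (hp : ‖p‖ = 1) :
    Matrix.vecMulVec (stereoVec p) (star (stereoVec p)) =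
      ((stereoVec p ⬝ᵥ star (stereoVec p)) / 2) • (1 + pauli p) := by
  have hsq : p 0 ^ 2 + p 1 ^ 2 + p 2 ^ 2 = 1 := by
    simpa [hp, Fin.sum_univ_three] using (EuclideanSpace.norm_sq_eq p).symm
  by_cases hpole : p 2 = 1
  · have h0 : p 0 = 0 := by nlinarith
    have h1 : p 1 = 0 := by nlinarith
    have hvec : stereoVec p = ![1, 0] := if_pos hpole
    have hnorm : stereoVec p ⬝ᵥ star (stereoVec p) / 2 = 1 / 2 := by simp [hvec, dotProduct]
    rw [hnorm, hvec]
    ext i j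
    fin_cases i <;> fin_cases j <;>
      simp [pauli_apply, hpole, h0, h1, Matrix.vecMulVec_apply, one_add_one_eq_two]
  · have hsq' : (p 0 : ℂ) ^ 2 + (p 1 : ℂ) ^ 2 + (p 2 : ℂ) ^ 2 = 1 := by
      simpa only [Complex.ofReal_add, Complex.ofReal_pow, Complex.ofReal_one] using
        congrArg Complex.ofReal hsq
    have hvec : stereoVec p = ![p 0 + Complex.I * p 1, 1 - p 2] := if_neg hpole
    have hnorm : stereoVec p ⬝ᵥ star (stereoVec p) / 2 = 1 - p 2 := by
      simp [hvec, dotProduct, Fin.sum_univ_two]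
      linear_combination (hsq' - (p 1 : ℂ) ^ 2 * Complex.I_sq) / 2
    rw [hnorm, hvec]
    ext i j
    fin_cases i <;> fin_cases j <;> simp [pauli_apply, Matrix.vecMulVec_apply, sub_eq_add_neg]
    · linear_combination hsq' - (p 1 : ℂ) ^ 2 * Complex.I_sq
    · ring

theorem dotProduct_stereoVec_mul_conj (hp : ‖p‖ = 1) (hq : ‖q‖ = 1) :
    (stereoVec q ⬝ᵥ star (stereoVec p)) * conj (stereoVec q ⬝ᵥ star (stereoVec p)) =
      (stereoVec p ⬝ᵥ star (stereoVec p)) * (stereoVec q ⬝ᵥ star (stereoVec q)) / 2 *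
        (1 + inner ℝ p q : ℝ) := by
  rw [dotProduct_mul_conj, vecMulVec_stereoVec hp, vecMulVec_stereoVec hq, Matrix.smul_mul,
    Matrix.mul_smul, Matrix.trace_smul, Matrix.trace_smul, trace_one_add_pauli_mul, smul_eq_mul,
    smul_eq_mul]
  ring

theorem bracket_mul_conj_dotProduct_stereoVec (hq : ‖q‖ = 1) (s : Fin 2 → ℂ) :
    bracket s (stereoVec q) * conj (stereoVec q ⬝ᵥ star s) =
      stereoVec q ⬝ᵥ star (stereoVec q) / 2 * bracket s (pauli q *ᵥ s) := by
  rw [bracket_mul_conj_dotProduct, vecMulVec_stereoVec hq, Matrix.smul_mulVec, Matrix.add_mulVec,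
    Matrix.one_mulVec]
  simp only [bracket, Pi.smul_apply, Pi.add_apply, smul_eq_mul]
  ring

theorem bracket_pauli_mulVec_stereoVec (hp : ‖p‖ = 1) :
    bracket (stereoVec p) (pauli p *ᵥ stereoVec p) = 0 := by
  have h := bracket_mul_conj_dotProduct_stereoVec hp (stereoVec p)
  have hself : bracket (stereoVec p) (stereoVec p) = 0 := by rw [bracket]; ring
  rw [hself, zero_mul, eq_comm] at h
  exact (mul_eq_zero.1 h).resolve_left (div_ne_zero (dotProduct_stereoVec_ne_zero p) two_ne_zero)

theorem stereo_eq_toProj (p : EuclideanSpace ℝ (Fin 3)) : stereo p = toProj (stereoVec p) :=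
  (toProj_of_ne_zero _).symm

theorem stereo_neg (hp : ‖p‖ = 1) : stereo (-p) = antipode (stereo p) := by
  set s := stereoVec p
  set v := stereoVec (-p)
  have horth : v ⬝ᵥ star s = 0 := by
    have h := dotProduct_stereoVec_mul_conj hp (norm_neg p ▸ hp : ‖-p‖ = 1)
    rw [inner_neg_right, real_inner_self_eq_norm_sq, hp, one_pow, add_neg_cancel,
      Complex.ofReal_zero, mul_zero] at h
    exact (mul_eq_zero.1 h).elim id (map_eq_zero _).1
  have hdecomp := smul_eq_smul_add_smul_quat s v
  rw [horth, zero_smul, zero_add] at hdecomp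
  have hbracket : bracket s v ≠ 0 := fun h0 => by
    rw [h0, zero_smul] at hdecomp
    exact smul_ne_zero (dotProduct_stereoVec_ne_zero p) (stereoVec_ne_zero (-p)) hdecomp
  rw [stereo_eq_toProj, stereo_eq_toProj, antipode_toProj (stereoVec_ne_zero p),
    ← toProj_smul (dotProduct_stereoVec_ne_zero p), hdecomp, toProj_smul hbracket]

/-- The coefficient of `q` in the frame `(s, quat s)` of `ℂ²` given by the representative `s` of
`stereo p`: the point `stereo q` is the line through `s + stereoCoeff p q • quat s`. -/
def stereoCoeff (p q : EuclideanSpace ℝ (Fin 3)) : ℂ :=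
  bracket (stereoVec p) (pauli q *ᵥ stereoVec p) /
    ((stereoVec p ⬝ᵥ star (stereoVec p)) * (1 + inner ℝ p q : ℝ))

theorem dotProduct_mul_stereoCoeff (hp : ‖p‖ = 1) (hq : ‖q‖ = 1) (hpq : 1 + inner ℝ p q ≠ 0) :
    stereoVec q ⬝ᵥ star (stereoVec p) ≠ 0 ∧
    (stereoVec q ⬝ᵥ star (stereoVec p)) * stereoCoeff p q =
      bracket (stereoVec p) (stereoVec q) := by
  have hN := dotProduct_stereoVec_ne_zero p
  have hM := dotProduct_stereoVec_ne_zero q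
  have hpq' : ((1 + inner ℝ p q : ℝ) : ℂ) ≠ 0 := Complex.ofReal_ne_zero.2 hpq
  have hα := dotProduct_stereoVec_mul_conj hp hq
  have hβ := bracket_mul_conj_dotProduct_stereoVec hq (stereoVec p)
  have hα0 := hα.trans_ne (mul_ne_zero (div_ne_zero (mul_ne_zero hN hM) two_ne_zero) hpq')
  refine ⟨left_ne_zero_of_mul hα0, mul_right_cancel₀ (right_ne_zero_of_mul hα0) ?_⟩
  rw [mul_right_comm, hα, hβ, stereoCoeff]
  field_simp

theorem stereo_eq_toProj_add_smul (hp : ‖p‖ = 1) (hq : ‖q‖ = 1) (hpq : 1 + inner ℝ p q ≠ 0) :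
    stereo q = toProj (stereoVec p + stereoCoeff p q • quat (stereoVec p)) := by
  obtain ⟨hα, hβ⟩ := dotProduct_mul_stereoCoeff hp hq hpq
  rw [stereo_eq_toProj, ← toProj_smul (dotProduct_stereoVec_ne_zero p),
    smul_eq_smul_add_smul_quat, ← hβ, mul_smul, ← smul_add, toProj_smul hα]

theorem stereoCoeff_mul_conj (hp : ‖p‖ = 1) (hq : ‖q‖ = 1) (hpq : 1 + inner ℝ p q ≠ 0) :
    stereoCoeff p q * conj (stereoCoeff p q) =
      ((1 - inner ℝ p q) / (1 + inner ℝ p q) : ℝ) := by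
  obtain ⟨-, hβ⟩ := dotProduct_mul_stereoCoeff hp hq hpq
  have hpq' : ((1 + inner ℝ p q : ℝ) : ℂ) ≠ 0 := Complex.ofReal_ne_zero.2 hpq
  have hα' := dotProduct_stereoVec_mul_conj hp hq
  have hβ' := bracket_mul_conj (stereoVec p) (stereoVec q)
  rw [← hβ, map_mul, mul_mul_mul_comm, hα'] at hβ'
  have hN := dotProduct_stereoVec_ne_zero p
  have hM := dotProduct_stereoVec_ne_zero q
  rw [Complex.ofReal_div, eq_div_iff hpq']
  refine mul_left_cancel₀ (div_ne_zero (mul_ne_zero hN hM) two_ne_zero) ?_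
  push_cast at hβ' ⊢
  linear_combination hβ'

theorem exists_stereo_eq_pencil {n : ℕ} {r : Fin (n + 1) → EuclideanSpace ℝ (Fin 3)}
    (hr : ∀ i, ‖r i‖ = 1) {κ : ℝ} (hκ : 1 + κ ≠ 0)
    (hinner : ∀ j : Fin n, inner ℝ (r 0) (r j.succ) = κ) (hsum : ∑ i, r i = 0) :
    ∃ (l : Fin 2 → ℂ) (a : Fin n → ℂ), l ≠ 0 ∧
      (fun i => stereo (r i)) = (fun i => toProj (pencil l (quat l) a i)) ∧
      ∑ j, a j = 0 ∧ ∀ j, a j * conj (a j) = ((1 - κ) / (1 + κ) : ℝ) := by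
  refine ⟨stereoVec (r 0), fun j => stereoCoeff (r 0) (r j.succ), stereoVec_ne_zero _,
    funext fun i => ?_, ?_, fun j => ?_⟩
  · cases i using Fin.cases with
    | zero => exact stereo_eq_toProj _
    | succ j => exact stereo_eq_toProj_add_smul (hr 0) (hr _) (by rwa [hinner])
  · have hsum' : r 0 + ∑ j : Fin n, r j.succ = 0 := by rw [← Fin.sum_univ_succ, hsum]
    have hbracket : ∑ j : Fin n, bracket (stereoVec (r 0)) (pauli (r j.succ) *ᵥ stereoVec (r 0)) =
        -bracket (stereoVec (r 0)) (pauli (r 0) *ᵥ stereoVec (r 0)) := by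
      rw [sum_bracket, ← Matrix.sum_mulVec, ← map_sum, eq_neg_of_add_eq_zero_right hsum', map_neg,
        Matrix.neg_mulVec, bracket_neg]
    simp only [stereoCoeff, hinner]
    rw [← Finset.sum_div, hbracket, bracket_pauli_mulVec_stereoVec (hr 0), neg_zero, zero_div]
  · rw [stereoCoeff_mul_conj (hr 0) (hr _) (by rwa [hinner]), hinner]

end Stereographic

/-! ## The four shapes -/

section Shapes

open scoped ComplexConjugate

variable (g : EuclideanSpace ℝ (Fin 3) ≃ₗᵢ[ℝ] EuclideanSpace ℝ (Fin 3))

theorem inner_euclideanSpace_three (p q : EuclideanSpace ℝ (Fin 3)) :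
    inner ℝ p q = p 0 * q 0 + p 1 * q 1 + p 2 * q 2 := by
  simp only [PiLp.inner_apply, Fin.sum_univ_three, RCLike.inner_apply, conj_trivial, mul_comm]

theorem norm_rawVertex_triangle (i : Fin 3) : ‖Shape.rawVertex .triangle i‖ = 2 := by
  rw [← sq_eq_sq₀ (norm_nonneg _) zero_le_two, ← real_inner_self_eq_norm_sq,
    inner_euclideanSpace_three]
  fin_cases i <;> simp [Shape.rawVertex] <;> norm_num

theorem norm_rawVertex_tetrahedron (i : Fin 4) : ‖Shape.rawVertex .tetrahedron i‖ = √3 := by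
  rw [← sq_eq_sq₀ (norm_nonneg _) (Real.sqrt_nonneg 3), ← real_inner_self_eq_norm_sq,
    inner_euclideanSpace_three]
  fin_cases i <;> simp [Shape.rawVertex] <;> norm_num

theorem exists_stereo_normalize_eq_pencil {n : ℕ} {r : Fin (n + 1) → EuclideanSpace ℝ (Fin 3)}
    {c κ : ℝ} (hc : c ≠ 0) (hr : ∀ i, ‖r i‖ = c) (hκ : 1 + κ ≠ 0)
    (hinner : ∀ j : Fin n, inner ℝ (r 0) (r j.succ) = κ * c ^ 2) (hsum : ∑ i, r i = 0) :
    ∃ (l : Fin 2 → ℂ) (a : Fin n → ℂ), l ≠ 0 ∧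
      (fun i => stereo (g (‖r i‖⁻¹ • r i))) = (fun i => toProj (pencil l (quat l) a i)) ∧
      ∑ j, a j = 0 ∧ ∀ j, a j * conj (a j) = ((1 - κ) / (1 + κ) : ℝ) := by
  refine exists_stereo_eq_pencil (fun i => ?_) hκ (fun j => ?_) ?_
  · rw [g.norm_map, norm_smul, norm_inv, norm_norm, hr, inv_mul_cancel₀ hc]
  · rw [g.inner_map_map, real_inner_smul_left, real_inner_smul_right, hr, hr, hinner]
    field_simp
  · simp only [hr]
    rw [← map_sum, ← Finset.smul_sum, hsum, smul_zero, map_zero]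

theorem exists_isAntipodalCovariant_triangle :
    ∃ Ψ m, IsAntipodalCovariant (config .triangle g) Ψ m := by
  have hsum : ∑ i : Fin 3, Shape.rawVertex .triangle i = 0 := by
    ext k
    fin_cases k <;> simp [Fin.sum_univ_three, Shape.rawVertex]
    norm_num
  have hinner : ∀ j : Fin 2, inner ℝ (Shape.rawVertex .triangle (0 : Fin 3))
      (Shape.rawVertex .triangle j.succ) = -1 / 2 * 2 ^ 2 := fun j => by
    rw [inner_euclideanSpace_three]
    fin_cases j <;> simp [Shape.rawVertex] <;> norm_num
  obtain ⟨l, a, hl, hconfig, ha, hnorm⟩ := exists_stereo_normalize_eq_pencil g two_ne_zero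
    norm_rawVertex_triangle (by norm_num) hinner hsum
  have hconfig' : config .triangle g = fun i => toProj (pencil l (quat l) a i) := hconfig
  rw [hconfig']
  exact ⟨_, _, isAntipodalCovariant_cubicCovariant hl ha fun j => by rw [hnorm]; norm_num⟩

theorem exists_isAntipodalCovariant_tetrahedron :
    ∃ Ψ m, IsAntipodalCovariant (config .tetrahedron g) Ψ m := by
  have hsum : ∑ i : Fin 4, Shape.rawVertex .tetrahedron i = 0 := by
    ext k
    fin_cases k <;> simp [Fin.sum_univ_four, Shape.rawVertex]
  have hinner : ∀ j : Fin 3, inner ℝ (Shape.rawVertex .tetrahedron (0 : Fin 4))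
      (Shape.rawVertex .tetrahedron j.succ) = -1 / 3 * √3 ^ 2 := fun j => by
    rw [inner_euclideanSpace_three]
    fin_cases j <;> simp [Shape.rawVertex]
  obtain ⟨l, a, hl, hconfig, ha, hnorm⟩ := exists_stereo_normalize_eq_pencil g
    (Real.sqrt_ne_zero'.2 three_pos) norm_rawVertex_tetrahedron (by norm_num) hinner hsum
  have hconfig' : config .tetrahedron g = fun i => toProj (pencil l (quat l) a i) := hconfig
  rw [hconfig']
  exact ⟨_, _, isAntipodalCovariant_quarticHessian hl ha fun j => by rw [hnorm]; norm_num⟩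

theorem isAntipodalCovariant_config_of_rawVertex_neg {s : Shape} (h0 : ∀ i, s.rawVertex i ≠ 0)
    (σ : Equiv.Perm (Fin s.card)) (hσ : ∀ i, s.rawVertex (σ i) = -s.rawVertex i) :
    IsAntipodalCovariant (config s g) id 1 := by
  refine isAntipodalCovariant_id σ (funext fun i => ?_)
  have hnorm : ‖g (s.vertex i)‖ = 1 := (g.norm_map _).trans (norm_smul_inv_norm (h0 i))
  have hvertex : s.vertex (σ i) = -s.vertex i := by
    rw [Shape.vertex, Shape.vertex, hσ, norm_neg, smul_neg]
  rw [Function.comp_apply, Function.comp_apply, config, config, hvertex, map_neg, stereo_neg hnorm]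

theorem isAntipodalCovariant_octahedron : IsAntipodalCovariant (config .octahedron g) id 1 := by
  have hinvol : Function.Involutive (![1, 0, 3, 2, 5, 4] : Fin 6 → Fin 6) := by
    unfold Function.Involutive
    decide
  have h0 : ∀ i : Fin 6, Shape.rawVertex .octahedron i ≠ 0 := fun i => by
    fin_cases i <;> simp [Shape.rawVertex]
  have hneg : ∀ i : Fin 6, Shape.rawVertex .octahedron (hinvol.toPerm _ i) =
      -Shape.rawVertex .octahedron i := fun i => by
    ext k
    fin_cases i <;> fin_cases k <;> simp [Shape.rawVertex]
  exact isAntipodalCovariant_config_of_rawVertex_neg g h0 (hinvol.toPerm _) hneg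

theorem isAntipodalCovariant_icosahedron : IsAntipodalCovariant (config .icosahedron g) id 1 := by
  have hinvol : Function.Involutive
      (![3, 2, 1, 0, 7, 6, 5, 4, 11, 10, 9, 8] : Fin 12 → Fin 12) := by
    unfold Function.Involutive
    decide
  have h0 : ∀ i : Fin 12, Shape.rawVertex .icosahedron i ≠ 0 := fun i => by
    fin_cases i <;> simp [Shape.rawVertex]
  have hneg : ∀ i : Fin 12, Shape.rawVertex .icosahedron (hinvol.toPerm _ i) =
      -Shape.rawVertex .icosahedron i := fun i => by
    ext k
    fin_cases i <;> fin_cases k <;> simp [Shape.rawVertex]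
  exact isAntipodalCovariant_config_of_rawVertex_neg g h0 (hinvol.toPerm _) hneg

theorem exists_isAntipodalCovariant (s : Shape) :
    ∃ Ψ m, IsAntipodalCovariant (config s g) Ψ m := by
  cases s with
  | triangle => exact exists_isAntipodalCovariant_triangle g
  | tetrahedron => exact exists_isAntipodalCovariant_tetrahedron g
  | octahedron => exact ⟨id, 1, isAntipodalCovariant_octahedron g⟩
  | icosahedron => exact ⟨id, 1, isAntipodalCovariant_icosahedron g⟩

end Shapes

end PlatonicLagrangian

end

open PlatonicLagrangian in
theorem mainTheorem11 (s : Shape)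
    (g : EuclideanSpace ℝ (Fin 3) ≃ₗᵢ[ℝ] EuclideanSpace ℝ (Fin 3)) :
    -- `τ` is given by `A · C ↦ A^‡ · C`, whatever the choice of `A`
    (∀ A : Matrix.SpecialLinearGroup (Fin 2) ℂ,
      tau (config s g) (orbitPoint (config s g) A) = orbitPoint (config s g) (ddag A)) ∧
    -- extension of `τ ∘ u` over the puncture
    (∀ U : Set ℂ, IsOpen U → (0 : ℂ) ∈ U →
      ∀ u : ℂ → ℙ ℂ (Fin (s.card + 1) → ℂ),
        HolomorphicOnOpen u U → Set.MapsTo u U (orbitClosure (config s g)) →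
        Set.MapsTo u (U \ {0}) (openOrbit (config s g)) →
        ∃ v : ℂ → ℙ ℂ (Fin (s.card + 1) → ℂ), ContinuousOn v U ∧
          Set.MapsTo v U (orbitClosure (config s g)) ∧
          Set.EqOn v (tau (config s g) ∘ u) (U \ {0})) ∧
    -- doubling of holomorphic discs to holomorphic spheres
    (∀ u : ℂ → ℙ ℂ (Fin (s.card + 1) → ℂ), IsHolomorphicDisc (config s g) u →
      ∃ w : OnePoint ℂ → ℙ ℂ (Fin (s.card + 1) → ℂ), HolomorphicSphere w ∧
        (∀ x, w x ∈ orbitClosure (config s g)) ∧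
        (∀ z ∈ Metric.closedBall (0 : ℂ) 1, w (z : OnePoint ℂ) = u z) ∧
        (∀ z ∈ Metric.closedBall (0 : ℂ) 1, u z ∈ openOrbit (config s g) →
          w (reflect z) = tau (config s g) (u z))) := by
  obtain ⟨Ψ, m, h⟩ := exists_isAntipodalCovariant g s
  exact ⟨h.tau_orbitPoint,
    fun U hU _ u hu huX huW => h.exists_continuousOn_extension hU hu huX huW,
    fun u hu => h.exists_holomorphicSphere hu⟩
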